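/- Let $M$ be a non-empty compact Hausdorff smooth manifold without boundary, of dimension $n\ge 1$. Let $\Gamma(S^2T^*M)$ be the space of smooth symmetric $\binom02$-tensor fields and $\mathcal M(M)\subset\Gamma(S^2T^*M)$ the open subset of Riemannian metrics. For $g\in\mathcal M(M)$ put $g^0_2(h,k)=\operatorname{Tr}(g^{-1}hg^{-1}k)$ and $\widetilde g^0_2(h,k)=\int_M g^0_2(h,k)\operatorname{vol}(g)$. For $g\in\mathcal M(M)$ let $P_g:\Gamma(S^2T^*M)\to\Gamma(S^2T^*M)$ be a linear bijection that is symmetric and positive with respect to $\widetilde g^0_2$ and depends smoothly on $g$ (that is, $(g,h)\mapsto P_gh$ maps smooth curves to smooth curves). It defines the weak Riemannian metric $G^P_g(h,k)=\widetilde g^0_2(P_gh,k)$ on $\mathcal M(M)$, whose geodesics are the smooth curves $g(t)$ with $g_{tt}=\tfrac12H_g(g_t,g_t)-K_g(g_t,g_t)$, where $D_{(g,m)}G^P(h,k)=G^P_g(K_g(h,m),k)=G^P_g(m,H_g(h,k))$ for constant $h,k$; equivalently, for every $k\in\Gamma(S^2T^*M)$, $$G^P_g(g_{tt},k)=\tfrac12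 D_{(g,k)}G^P(g_t,g_t)-D_{(g,g_t)}G^P(g_t,k).$$ Here $D_{(g,m)}$ is the derivative at $g$ in the direction $m$. Assume that there is an adjoint $(D_{(g,\cdot)}Ph)^*(k)\in\Gamma(S^2T^*M)$, smooth in $(g,h,k)$ and bilinear in $(h,k)$, with $\widetilde g^0_2\big((D_{(g,m)}P)h,k\big)=\widetilde g^0_2\big(m,(D_{(g,\cdot)}Ph)^*(k)\big)$ for all $g\in\mathcal M(M)$ and all $m,h,k\in\Gamma(S^2T^*M)$. Let $g_0\in\mathcal M(M)$ and $\mathcal N=\mathbb R_{>0}\,g_0=\{rg_0:r>0\}$, and suppose that $P$ restricts to $\mathcal N$: $P_gh\in T_g\mathcal N$ for all $g\in\mathcal N$, $h\in T_g\mathcal N$. Then the following are equivalent: (a) $\mathcal N$ is totally geodesic in $(\mathcal M(M),G^P)$: for all $g\in\mathcal N$ and $h\in T_g\mathcal N$ there is a geodesic of $\mathcal M(M)$ with initial position $g$ and initial velocity $h$ that stays in $\mathcal N$ for a short time; (b) $(D_{(g,\cdot)}Ph)^*(k)\in T_g\mathcal N$ for all $g\in\mathcal N$ and $h,k\in T_g\mathcal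 N$; (c) $(D_{(g,m)}P)h$ is $\widetilde g^0_2$-normal to $\mathcal N$ for all $g\in\mathcal N$, $h\in T_g\mathcal N$ and all $m\in\Gamma(S^2T^*M)$ that are $\widetilde g^0_2$-normal to $\mathcal N$ at $g$. If (a)–(c) hold, then there are functions $\Psi,f:\mathbb R_{>0}\to\mathbb R$, with $\Psi$ differentiable, such that for all $r>0$ $$P_{rg_0}(g_0)=\Psi(r)\,g_0,\qquad (D_{(rg_0,\cdot)}Pg_0)^*(g_0)=f(r)\,g_0,$$ and for every smooth function $r>0$ on an open set of times, the path $t\mapsto r(t)g_0$ is a geodesic in $\mathcal M(M)$ if and only if $$r''\,\Psi(r)=r'^2\Big(\tfrac12f(r)-\Psi'(r)+\big(1-\tfrac n4\big)\frac{\Psi(r)}{r}\Big).$$ Along these geodesics $g(t)=r(t)g_0$ the conserved momentum vanishes: $(\nabla^*P_gg_t)\operatorname{vol}(g)=0$, where $\nabla^*h=-\operatorname{Tr}^g(\nabla h)$ for the Levi-Civita connection $\nabla$ of $g$. -/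

import Mathlib

open Set Filter Topology Bundle Manifold
open scoped ContDiff

noncomputable section

namespace MetricSpaceOfMetrics

/-- The model space `ℝⁿ`. -/
abbrev Model (n : ℕ) : Type := EuclideanSpace ℝ (Fin n)

/-- The `i`-th standard basis vector of `ℝⁿ`. -/
def stdVec {n : ℕ} (i : Fin n) : Model n := EuclideanSpace.single i 1

/-- The fibre `T_x^*M ⊗ T_x^*M` of the bundle of `(0,2)`-tensors. -/
abbrev Cotensor (n : ℕ) {M : Type*} [TopologicalSpace M] [ChartedSpace (Model n) M] (x : M) :
    Type :=
  TangentSpace (𝓡 n) x →L[ℝ] TangentSpace (𝓡 n) x →L[ℝ] ℝ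

section Fields

variable (n : ℕ) (M : Type*) [TopologicalSpace M] [ChartedSpace (Model n) M]
  [IsManifold (𝓡 n) ∞ M]

/-- The smooth `(0,2)`-tensor fields on `M`. -/
abbrev CotensorField : Type _ :=
  ContMDiffSection (𝓡 n) (Model n →L[ℝ] Model n →L[ℝ] ℝ) ∞ (fun x : M => Cotensor n x)

set_option synthInstance.maxHeartbeats 200000 in
instance instAddCommGroupCotensorField : AddCommGroup (CotensorField n M) :=
  ContMDiffSection.instAddCommGroup

set_option synthInstance.maxHeartbeats 200000 in
instance instModuleCotensorField : Module ℝ (CotensorField n M) :=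
  ContMDiffSection.instModule

/-- The smooth symmetric `(0,2)`-tensor fields, as a subspace of all smooth `(0,2)`-tensor
fields. -/
def symmetricFields : Submodule ℝ (CotensorField n M) where
  carrier := {h | ∀ (x : M) (u v : TangentSpace (𝓡 n) x), h x u v = h x v u}
  add_mem' := by
    intro h k hh hk x u v
    have e : ∀ a b : TangentSpace (𝓡 n) x, (h + k) x a b = h x a b + k x a b := fun _ _ => rfl
    rw [e, e, hh x u v, hk x u v]
  zero_mem' := by
    intro x u v
    rfl
  smul_mem' := by
    intro c h hh x u v
    have e : ∀ a b : TangentSpace (𝓡 n) x, (c • h) x a b = c * h x a b := fun _ _ => rfl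
    rw [e, e, hh x u v]

/-- `Γ(S²T*M)`: the real vector space of smooth symmetric `(0,2)`-tensor fields on `M`. -/
abbrev SymTensor : Type _ := ↥(symmetricFields n M)

instance instAddCommGroupSymTensor : AddCommGroup (SymTensor n M) :=
  Submodule.addCommGroup (symmetricFields n M)

instance instModuleSymTensor : Module ℝ (SymTensor n M) :=
  Submodule.module (symmetricFields n M)

instance instSMulSymTensor : SMul ℝ (SymTensor n M) :=
  (instModuleSymTensor n M).toSMul

instance instAddSymTensor : Add (SymTensor n M) :=
  (instAddCommGroupSymTensor n M).toAdd

instance instNegSymTensor : Neg (SymTensor n M) :=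
  (instAddCommGroupSymTensor n M).toNeg

instance instSubSymTensor : Sub (SymTensor n M) :=
  (instAddCommGroupSymTensor n M).toSub

instance instZeroSymTensor : Zero (SymTensor n M) :=
  AddCommGroup.toAddGroup.toSubNegMonoid.toAddMonoid.toZero

/-- `𝓜(M) ⊂ Γ(S²T*M)`: the set of all smooth Riemannian metrics on `M`. -/
def riemannianMetrics : Set (SymTensor n M) :=
  {g | ∀ (x : M) (u : TangentSpace (𝓡 n) x), u ≠ 0 → 0 < g.1 x u u}

/-- A field of bilinear functions on the tangent spaces, without any regularity. -/
abbrev RawTensor : Type _ :=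
  (x : M) → TangentSpace (𝓡 n) x → TangentSpace (𝓡 n) x → ℝ

/-- A density: at each point `x` a function of the `n`-frames of `T_xM`. -/
abbrev Density : Type _ := (x : M) → (Fin n → TangentSpace (𝓡 n) x) → ℝ

end Fields

variable {n : ℕ} {M : Type*} [TopologicalSpace M] [ChartedSpace (Model n) M]
  [IsManifold (𝓡 n) ∞ M]

/-- A symmetric tensor field as a field of bilinear functions. -/
def SymTensor.raw (h : SymTensor n M) : RawTensor n M := fun x u v => h.1 x u v

/-- The matrix `b (w i) (w j)` of a bilinear function `b` in a frame `w`. -/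
def frameMatrix {x : M} (w : Fin n → TangentSpace (𝓡 n) x)
    (b : TangentSpace (𝓡 n) x → TangentSpace (𝓡 n) x → ℝ) : Matrix (Fin n) (Fin n) ℝ :=
  Matrix.of fun i j => b (w i) (w j)

/-- The standard frame of `T_xM`, which in Mathlib is a copy of `ℝⁿ`. -/
def stdFrame (x : M) : Fin n → TangentSpace (𝓡 n) x := fun i => (stdVec i : Model n)

/-- `g⁰₂(h,k) = Tr(g⁻¹ h g⁻¹ k)` at the point `x` (the trace does not depend on the frame). -/
def fibreInner (g : SymTensor n M) (h k : RawTensor n M) (x : M) : ℝ :=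
  let G := frameMatrix (stdFrame x) (g.raw x)
  (G⁻¹ * frameMatrix (stdFrame x) (h x) * G⁻¹ * frameMatrix (stdFrame x) (k x)).trace

/-- The volume density `vol(g)`: on a frame `w` it is `√det g(w i, w j)`. -/
def volDensity (g : SymTensor n M) : Density n M :=
  fun x w => √(frameMatrix w (g.raw x)).det

/-- The coordinate frame `∂₁, …, ∂ₙ` of the chart around `x₀`, at the point with coordinates
`y`. -/
def coordFrame (x₀ : M) (y : Model n) :
    Fin n → TangentSpace (𝓡 n) ((extChartAt (𝓡 n) x₀).symm y) :=
  fun i => mfderiv 𝓘(ℝ, Model n) (𝓡 n) (extChartAt (𝓡 n) x₀).symm y (stdVec i : Model n)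

section Integration

variable (n M)
variable [CompactSpace M] [T2Space M]

/-- A smooth partition of unity subordinate to the charts around the points of `M`. -/
def chartPartition : SmoothPartitionOfUnity M (𝓡 n) M univ :=
  Classical.choose (SmoothPartitionOfUnity.exists_isSubordinate_chartAt_source (𝓡 n) M)

variable {n M}

/-- The integral over `M` of a density `μ`: the sum over a partition of unity `ρ` of the Lebesgue
integrals `∫ ρ_c(y) μ_y(∂₁, …, ∂ₙ) dy` over the domains of the charts. -/
def integralDensity (μ : Density n M) : ℝ :=
  ∑ᶠ c : M, ∫ y in (extChartAt (𝓡 n) c).target,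
    chartPartition n M c ((extChartAt (𝓡 n) c).symm y) *
      μ ((extChartAt (𝓡 n) c).symm y) (coordFrame c y)

/-- The `L²` inner product `∫_M g⁰₂(h,k) vol(g)` of `(0,2)`-tensor fields. -/
def innerL2 (g : SymTensor n M) (h k : RawTensor n M) : ℝ :=
  integralDensity fun x w => fibreInner g h k x * volDensity g x w

end Integration

section Curves

/-- The curve `c` in `Γ(S²T*M)` is smooth on `J`: `(t, x) ↦ c t x` is jointly smooth on
`J × M`. -/
def IsSmoothCurveOn (J : Set ℝ) (c : ℝ → SymTensor n M) : Prop :=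
  ContMDiffOn (𝓘(ℝ, ℝ).prod (𝓡 n)) ((𝓡 n).prod 𝓘(ℝ, Model n →L[ℝ] Model n →L[ℝ] ℝ)) ∞
    (fun p : ℝ × M =>
      (TotalSpace.mk' (Model n →L[ℝ] Model n →L[ℝ] ℝ) p.2 ((c p.1).1 p.2) :
        TotalSpace (Model n →L[ℝ] Model n →L[ℝ] ℝ) (fun x : M => Cotensor n x)))
    (J ×ˢ univ)

/-- The curve `c` in `Γ(S²T*M)` has velocity `h` at time `t`. -/
def HasVelocity (c : ℝ → SymTensor n M) (t : ℝ) (h : SymTensor n M) : Prop :=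
  ∀ (x : M) (u v : TangentSpace (𝓡 n) x), HasDerivAt (fun s => (c s).1 x u v) (h.1 x u v) t

/-- The tangent space `T_gN` of a submanifold `N` of `𝓜(M)`: the velocities at `g` of the smooth
curves in `N`. -/
def tangentTo (N : Set (SymTensor n M)) (g : SymTensor n M) : Set (SymTensor n M) :=
  {h | ∃ c : ℝ → SymTensor n M,
    IsSmoothCurveOn univ c ∧ (∀ t, c t ∈ N) ∧ c 0 = g ∧ HasVelocity c 0 h}

/-- The ray `ℝ_{>0} g₀`. -/
def ray (g₀ : SymTensor n M) : Set (SymTensor n M) := {g | ∃ r : ℝ, 0 < r ∧ g = r • g₀}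

end Curves

section Operator

variable [CompactSpace M] [T2Space M]

/-- The derivative `(D_{(g,m)}P)h = ∂_s|₀ P_{g+sm}h`, pointwise on `M`. -/
def derivOperator (P : SymTensor n M → SymTensor n M →ₗ[ℝ] SymTensor n M)
    (g m h : SymTensor n M) : RawTensor n M :=
  fun x u v => deriv (fun s : ℝ => (P (g + s • m) h).1 x u v) 0

/-- `P` is a family of operators `P_g : Γ(S²T*M) → Γ(S²T*M)`, `g ∈ 𝓜(M)`, that are bijective,
symmetric and positive for the `L²` inner product of `g`, and that depend smoothly on `g`: smooth
curves of metrics and of tensor fields are mapped to smooth curves.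
The values `P g` at a `g` that is not a Riemannian metric are irrelevant. -/
structure IsMetricOperator (P : SymTensor n M → SymTensor n M →ₗ[ℝ] SymTensor n M) : Prop where
  bijective : ∀ g ∈ riemannianMetrics n M, Function.Bijective (P g)
  symmetric : ∀ g ∈ riemannianMetrics n M, ∀ h k : SymTensor n M,
    innerL2 g (P g h).raw k.raw = innerL2 g h.raw (P g k).raw
  positive : ∀ g ∈ riemannianMetrics n M, ∀ h : SymTensor n M, h ≠ 0 →
    0 < innerL2 g (P g h).raw h.raw
  smooth : ∀ c h : ℝ → SymTensor n M, IsSmoothCurveOn univ c → IsSmoothCurveOn univ h →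
    (∀ t, c t ∈ riemannianMetrics n M) → IsSmoothCurveOn univ fun t => P (c t) (h t)

/-- `A g h k` is the adjoint `(D_{(g,·)}Ph)^*(k)`:
`∫ g⁰₂((D_{(g,m)}P)h, k) vol(g) = ∫ g⁰₂(m, (D_{(g,·)}Ph)^*(k)) vol(g)` for all `m`. It is smooth
in `(g,h,k)`, and bilinear in `(h,k)`. -/
structure IsAdjoint (P : SymTensor n M → SymTensor n M →ₗ[ℝ] SymTensor n M)
    (A : SymTensor n M → SymTensor n M →ₗ[ℝ] SymTensor n M →ₗ[ℝ] SymTensor n M) : Prop where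
  adjoint : ∀ g ∈ riemannianMetrics n M, ∀ m h k : SymTensor n M,
    innerL2 g (derivOperator P g m h) k.raw = innerL2 g m.raw (A g h k).raw
  smooth : ∀ c h k : ℝ → SymTensor n M, IsSmoothCurveOn univ c → IsSmoothCurveOn univ h →
    IsSmoothCurveOn univ k → (∀ t, c t ∈ riemannianMetrics n M) →
    IsSmoothCurveOn univ fun t => A (c t) (h t) (k t)

/-- The weak Riemannian metric `G^P_g(h,k) = ∫ g⁰₂(P_g h, k) vol(g)` on `𝓜(M)`. -/
def metricP (P : SymTensor n M → SymTensor n M →ₗ[ℝ] SymTensor n M)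
    (g h k : SymTensor n M) : ℝ :=
  innerL2 g (P g h).raw k.raw

/-- `D_{(g,m)} G^P(h,k)`, for constant `h` and `k`. -/
def derivMetricP (P : SymTensor n M → SymTensor n M →ₗ[ℝ] SymTensor n M)
    (g m h k : SymTensor n M) : ℝ :=
  deriv (fun s : ℝ => metricP P (g + s • m) h k) 0

/-- `c` is a geodesic of `(𝓜(M), G^P)` on the open set `J` of times:
`c_tt = ½ H(c_t, c_t) - K(c_t, c_t)`, where `H` and `K` are the metric gradients
`D_{(g,m)}G^P(h,k) = G^P(K(h,m), k) = G^P(m, H(h,k))`. The equation is written out after pairing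
with an arbitrary `k` under `G^P`. -/
def IsGeodesicOn (P : SymTensor n M → SymTensor n M →ₗ[ℝ] SymTensor n M)
    (J : Set ℝ) (c : ℝ → SymTensor n M) : Prop :=
  IsSmoothCurveOn J c ∧ (∀ t ∈ J, c t ∈ riemannianMetrics n M) ∧
    ∃ v a : ℝ → SymTensor n M, ∀ t ∈ J,
      HasVelocity c t (v t) ∧ HasVelocity v t (a t) ∧
      ∀ k : SymTensor n M,
        metricP P (c t) (a t) k =
          1 / 2 * derivMetricP P (c t) k (v t) (v t) - derivMetricP P (c t) (v t) (v t) k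

/-- `N` is totally geodesic in `(𝓜(M), G^P)`: for every `g ∈ N` and every `h ∈ T_gN` there is a
geodesic of `𝓜(M)` with initial data `(g, h)` that stays in `N` for a short time. -/
def IsTotallyGeodesic (P : SymTensor n M → SymTensor n M →ₗ[ℝ] SymTensor n M)
    (N : Set (SymTensor n M)) : Prop :=
  ∀ g ∈ N, ∀ h ∈ tangentTo N g, ∃ ε > 0, ∃ c : ℝ → SymTensor n M,
    IsGeodesicOn P (Ioo (-ε) ε) c ∧ c 0 = g ∧ HasVelocity c 0 h ∧ ∀ t ∈ Ioo (-ε) ε, c t ∈ N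

/-- The field `m` is normal to `N` at `g` for the `L²` inner product of `g`. -/
def IsNormalTo (N : Set (SymTensor n M)) (g : SymTensor n M) (m : RawTensor n M) : Prop :=
  ∀ k ∈ tangentTo N g, innerL2 g m k.raw = 0

end Operator

section Divergence

/-- The coefficients `h(∂_j, ∂_k)` of `h` in the chart around `x₀`, as functions of the
coordinates. -/
def coeff (h : SymTensor n M) (x₀ : M) (j k : Fin n) (y : Model n) : ℝ :=
  frameMatrix (coordFrame x₀ y) (h.raw ((extChartAt (𝓡 n) x₀).symm y)) j k

/-- The coefficients `g^{jk}` of the inverse metric in the chart around `x₀`. -/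
def invCoeff (g : SymTensor n M) (x₀ : M) (j k : Fin n) (y : Model n) : ℝ :=
  (frameMatrix (coordFrame x₀ y) (g.raw ((extChartAt (𝓡 n) x₀).symm y)))⁻¹ j k

/-- The partial derivative `∂_i F`. -/
def partialDeriv (i : Fin n) (F : Model n → ℝ) (y : Model n) : ℝ :=
  fderiv ℝ F y (stdVec i)

/-- The Christoffel symbols `Γ^l_{ij}` of the Levi-Civita connection of `g`. -/
def christoffel (g : SymTensor n M) (x₀ : M) (l i j : Fin n) (y : Model n) : ℝ :=
  1 / 2 * ∑ q, invCoeff g x₀ l q y *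
    (partialDeriv i (coeff g x₀ j q) y + partialDeriv j (coeff g x₀ i q) y -
      partialDeriv q (coeff g x₀ i j) y)

/-- The coefficients `(∇_i h)_{jk}` of the covariant derivative of `h` for the Levi-Civita
connection of `g`. -/
def covDeriv (g h : SymTensor n M) (x₀ : M) (i j k : Fin n) (y : Model n) : ℝ :=
  partialDeriv i (coeff h x₀ j k) y - ∑ l, christoffel g x₀ l i j y * coeff h x₀ l k y -
    ∑ l, christoffel g x₀ l i k y * coeff h x₀ j l y

/-- The one-form `∇^*h = -Tr^g(∇h)`, that is `(∇^*h)_k = - g^{ij} (∇_i h)_{jk}`. It is computed at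
`x` in the chart around `x`. -/
def nablaStar (g h : SymTensor n M) (x : M) (X : TangentSpace (𝓡 n) x) : ℝ :=
  -∑ i, ∑ j, ∑ k,
    invCoeff g x i j (extChartAt (𝓡 n) x x) * covDeriv g h x i j k (extChartAt (𝓡 n) x x) *
      (show Model n from mfderiv (𝓡 n) 𝓘(ℝ, Model n) (extChartAt (𝓡 n) x) x X) k

/-- The momentum `(∇^*P_g h) vol(g)`, a one-form with values in the densities, of a tangent vector
`h` at `g`. -/
def momentum (P : SymTensor n M → SymTensor n M →ₗ[ℝ] SymTensor n M) (g h : SymTensor n M) :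
    (x : M) → TangentSpace (𝓡 n) x → (Fin n → TangentSpace (𝓡 n) x) → ℝ :=
  fun x X w => nablaStar g (P g h) x X * volDensity g x w

end Divergence

end MetricSpaceOfMetrics

end

open MetricSpaceOfMetrics

/-!
The tangent space of the ray `ℝ_{>0} g₀` at each of its points is the line `ℝ g₀`
(`mem_tangentTo_ray_iff`), so `P_{r g₀} g₀ = Ψ(r) g₀`, with `Ψ` smooth because `P` preserves smooth
curves, and with `Ψ ≠ 0` because `P` is positive. Bijectivity and positivity of `P_g` also make the
inner product `⟨·,·⟩_g` on `Γ(S²T*M)` non-degenerate (`eq_zero_of_forall_innerL2_eq_zero`).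

The heart of the proof is the geodesic equation at `g = r g₀`. The derivative
`D_{(g,k)} G^P(g₀,g₀)` is computed under the integral (`derivMetricP_of_direction`): differentiating
`P` gives `⟨k, A_g(g₀,g₀)⟩_g` with the adjoint `A`, and differentiating `g⁻¹` and `vol(g)` gives
`(n/2 - 2) Ψ(r)/r ⟨g₀,k⟩_g`. The derivative `D_{(g,g₀)} G^P(g₀,k)` follows from the scaling
`⟨·,·⟩_{r g₀} = r^{n/2-2} ⟨·,·⟩_{g₀}`. Hence `r(t) g₀` solves the geodesic equation if and only if
`r'' Ψ(r) g₀ = r'² (½ A_g(g₀,g₀) + ((1 - n/4) Ψ(r)/r - Ψ'(r)) g₀)`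
(`geodesic_equation_on_ray_iff`).

If the ray is totally geodesic, this equation exhibits `A_g(g₀,g₀)` as a multiple of `g₀`.
Conversely, if `A_g(g₀,g₀) = f(r) g₀`, it becomes `r'' = r'² F(r)` with `F` smooth, which is solved
by two quadratures (`exists_smooth_solution_of_deriv_deriv_eq`). That `A_g(g₀,g₀)` lies in `ℝ g₀` is
also equivalent, by the defining property of the adjoint, to the statement that `(D_{(g,m)}P)g₀` is
normal to `g₀` whenever `m` is. Finally the momentum of `r(t) g₀` vanishes since `P_g g_t` is a
constant multiple of `g`, and `g` is parallel for its Levi-Civita connection.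

Differentiation under the integral is justified chart by chart. The partition of unity makes the
integrand vanish outside a compact set, the frame-independence of `Tr(g⁻¹hg⁻¹k)` makes it smooth in
the coordinates, and since `g + s k` is a metric for small `s` only
(`eventually_add_smul_mem_riemannianMetrics`), the line is replaced by a smooth curve of metrics
with the same germ before the smoothness of `P` is applied.
-/

namespace MetricSpaceOfMetrics

/-! ### Smooth curves of tensor fields in coordinates -/

section Smooth
variable {n : ℕ} {M : Type*} [TopologicalSpace M] [ChartedSpace (Model n) M]
  [IsManifold (𝓡 n) ∞ M]

/-- The coordinate vector fields are smooth along the inverse of the chart: they are its tangent map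
applied to constant fields. -/
theorem contMDiffOn_coordFrame (c : M) (i : Fin n) :
    ContMDiffOn 𝓘(ℝ, Model n) ((𝓡 n).prod 𝓘(ℝ, Model n)) ∞
      (fun y => (TotalSpace.mk' (Model n) ((extChartAt (𝓡 n) c).symm y) (coordFrame c y i) :
        TangentBundle (𝓡 n) M)) (extChartAt (𝓡 n) c).target := by
  have hopen := isOpen_extChartAt_target (I := 𝓡 n) c
  have h1 : ContMDiffOn 𝓘(ℝ, Model n) (𝓡 n) ∞ (extChartAt (𝓡 n) c).symm
      (extChartAt (𝓡 n) c).target := contMDiffOn_extChartAt_symm c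
  have h2 := h1.contMDiffOn_tangentMapWithin (m := ∞) (by simp) hopen.uniqueMDiffOn
  have h3 : ContMDiff 𝓘(ℝ, Model n) (𝓘(ℝ, Model n).prod 𝓘(ℝ, Model n)) ∞
      (fun y => (⟨y, stdVec i⟩ : TangentBundle 𝓘(ℝ, Model n) (Model n))) := by
    intro y
    rw [contMDiffAt_totalSpace]
    refine ⟨contMDiffAt_id, ?_⟩
    simp only [trivializationAt_model_space_apply]
    exact contMDiffAt_const
  have h4 := h2.comp h3.contMDiffOn (s := (extChartAt (𝓡 n) c).target) (fun y hy => hy)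
  refine h4.congr fun y hy => ?_
  simp only [Function.comp, tangentMapWithin, coordFrame]
  rw [mfderivWithin_of_isOpen hopen hy]

/-- The coefficients of a smooth curve of tensor fields are jointly smooth in time and in the
coordinates. -/
theorem IsSmoothCurveOn.contDiffOn_coordFrame {J : Set ℝ} {c : ℝ → SymTensor n M}
    (hc : IsSmoothCurveOn J c) (x₀ : M) (i j : Fin n) :
    ContDiffOn ℝ ∞ (fun p : ℝ × Model n =>
      frameMatrix (coordFrame x₀ p.2) ((c p.1).raw ((extChartAt (𝓡 n) x₀).symm p.2)) i j)
      (J ×ˢ (extChartAt (𝓡 n) x₀).target) := by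
  rw [← contMDiffOn_iff_contDiffOn, modelWithCornersSelf_prod, ← chartedSpaceSelf_prod]
  have h1 : ContMDiffOn 𝓘(ℝ, Model n) (𝓡 n) ∞ (extChartAt (𝓡 n) x₀).symm
      (extChartAt (𝓡 n) x₀).target := contMDiffOn_extChartAt_symm x₀
  have hsnd : ContMDiffOn (𝓘(ℝ, ℝ).prod 𝓘(ℝ, Model n)) 𝓘(ℝ, Model n) ∞
    (Prod.snd : ℝ × Model n → Model n) (J ×ˢ (extChartAt (𝓡 n) x₀).target) := contMDiffOn_snd
  have hfst : ContMDiffOn (𝓘(ℝ, ℝ).prod 𝓘(ℝ, Model n)) 𝓘(ℝ, ℝ) ∞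
    (Prod.fst : ℝ × Model n → ℝ) (J ×ˢ (extChartAt (𝓡 n) x₀).target) := contMDiffOn_fst
  have h2 := h1.comp hsnd (fun p hp => hp.2)
  have hψ := ContMDiffOn.comp hc (hfst.prodMk h2) (fun p hp => ⟨hp.1, mem_univ _⟩)
  have hi := (contMDiffOn_coordFrame x₀ i).comp hsnd (fun p hp => hp.2)
  have hj := (contMDiffOn_coordFrame x₀ j).comp hsnd (fun p hp => hp.2)
  have := ContMDiffOn.clm_bundle_apply₂ (F₁ := Model n) (F₂ := Model n) (F₃ := ℝ)
    (E₁ := TangentSpace (𝓡 n)) (E₂ := TangentSpace (𝓡 n)) (E₃ := fun _ : M => ℝ)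
    (b := fun p : ℝ × Model n => (extChartAt (𝓡 n) x₀).symm p.2)
    (ψ := fun p => (c p.1).1 ((extChartAt (𝓡 n) x₀).symm p.2))
    (v := fun p => coordFrame x₀ p.2 i) (w := fun p => coordFrame x₀ p.2 j) hψ hi hj
  intro p hp
  have h5 := this p hp
  simp only [contMDiffWithinAt_totalSpace] at h5
  exact h5.2

theorem IsSmoothCurveOn.contDiffOn_apply {J : Set ℝ} {c : ℝ → SymTensor n M}
    (hc : IsSmoothCurveOn J c) (x : M) (u v : TangentSpace (𝓡 n) x) :
    ContDiffOn ℝ ∞ (fun t => (c t).1 x u v) J := by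
  rw [← contMDiffOn_iff_contDiffOn]
  have hψ := ContMDiffOn.comp hc (f := fun t : ℝ => (t, x)) (s := J)
    (contMDiffOn_id.prodMk contMDiffOn_const) (fun p hp => ⟨hp, mem_univ _⟩)
  have := ContMDiffOn.clm_bundle_apply₂ (F₁ := Model n) (F₂ := Model n) (F₃ := ℝ)
    (E₁ := TangentSpace (𝓡 n)) (E₂ := TangentSpace (𝓡 n)) (E₃ := fun _ : M => ℝ)
    (b := fun t : ℝ => x)
    (ψ := fun p => (c p).1 x)
    (v := fun p => u) (w := fun p => v) hψ contMDiffOn_const contMDiffOn_const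
  intro p hp
  have h5 := this p hp
  simp only [contMDiffWithinAt_totalSpace] at h5
  exact h5.2


end Smooth

section AlongMap
variable {F B M : Type*} {E : B → Type*} {EB HB EM HM : Type*}
  [NormedAddCommGroup F] [NormedSpace ℝ F] [TopologicalSpace (TotalSpace F E)]
  [∀ x, TopologicalSpace (E x)] [∀ x, AddCommGroup (E x)] [∀ x, Module ℝ (E x)]
  [NormedAddCommGroup EB] [NormedSpace ℝ EB] [TopologicalSpace HB]
  {IB : ModelWithCorners ℝ EB HB} [TopologicalSpace B] [ChartedSpace HB B]
  [NormedAddCommGroup EM] [NormedSpace ℝ EM] [TopologicalSpace HM]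
  {IM : ModelWithCorners ℝ EM HM} [TopologicalSpace M] [ChartedSpace HM M]
  [FiberBundle F E] [VectorBundle ℝ F E]

/-- Linear combinations, with smooth coefficients, of smooth sections along a map `f` into the base
of a vector bundle are smooth. -/
theorem _root_.ContMDiffWithinAt.smul_add_smul_along {m : WithTop ℕ∞} {f : M → B}
    {s t : ∀ x, E (f x)} {a b : M → ℝ} {S : Set M} {p : M}
    (hs : ContMDiffWithinAt IM (IB.prod 𝓘(ℝ, F)) m (fun x => TotalSpace.mk' F (f x) (s x)) S p)
    (ht : ContMDiffWithinAt IM (IB.prod 𝓘(ℝ, F)) m (fun x => TotalSpace.mk' F (f x) (t x)) S p)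
    (ha : ContMDiffWithinAt IM 𝓘(ℝ, ℝ) m a S p) (hb : ContMDiffWithinAt IM 𝓘(ℝ, ℝ) m b S p) :
    ContMDiffWithinAt IM (IB.prod 𝓘(ℝ, F)) m
      (fun x => TotalSpace.mk' F (f x) (a x • s x + b x • t x)) S p := by
  have hf : ContinuousWithinAt f S p :=
    (contMDiffWithinAt_totalSpace.1 hs).1.continuousWithinAt
  rw [contMDiffWithinAt_totalSpace] at hs ht ⊢
  refine ⟨hs.1, ?_⟩
  -- the local trivialization around `f p` is linear on the fibres
  let e := trivializationAt F E (f p)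
  have hev : ∀ᶠ q in 𝓝[S] p, f q ∈ e.baseSet :=
    hf.eventually (e.open_baseSet.mem_nhds (FiberBundle.mem_baseSet_trivializationAt' (f p)))
  have key : ∀ q, f q ∈ e.baseSet → (e ⟨f q, a q • s q + b q • t q⟩).2 =
        a q • (e ⟨f q, s q⟩).2 + b q • (e ⟨f q, t q⟩).2 := fun q hq => by
    have hl := e.linear ℝ hq
    rw [hl.map_add, hl.map_smul, hl.map_smul]
  refine ((ha.smul hs.2).add (hb.smul ht.2)).congr_of_eventuallyEq ?_
    (key p (FiberBundle.mem_baseSet_trivializationAt' (f p)))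
  filter_upwards [hev] with q hq using key q hq

end AlongMap

section Smooth
variable {n : ℕ} {M : Type*} [TopologicalSpace M] [ChartedSpace (Model n) M]
  [IsManifold (𝓡 n) ∞ M]

theorem isSmoothCurveOn_smul_add_smul {J : Set ℝ} {a b : ℝ → ℝ} (ha : ContDiffOn ℝ ∞ a J)
    (hb : ContDiffOn ℝ ∞ b J) (h k : SymTensor n M) :
    IsSmoothCurveOn J (fun t => a t • h + b t • k) := by
  intro p hp
  have hh : ∀ h : SymTensor n M,
    ContMDiffWithinAt (𝓘(ℝ, ℝ).prod (𝓡 n)) ((𝓡 n).prod 𝓘(ℝ, Model n →L[ℝ] Model n →L[ℝ] ℝ)) ∞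
    (fun p : ℝ × M =>
      (TotalSpace.mk' (Model n →L[ℝ] Model n →L[ℝ] ℝ) p.2 (h.1 p.2) :
        TotalSpace (Model n →L[ℝ] Model n →L[ℝ] ℝ) (fun x : M => Cotensor n x)))
    (J ×ˢ univ) p := fun h =>
     (h.1.contMDiff.comp contMDiff_snd).contMDiffAt.contMDiffWithinAt
  exact ContMDiffWithinAt.smul_add_smul_along (hh h) (hh k)
    ((ha.contMDiffOn p.1 hp.1).comp p contMDiffWithinAt_fst (fun q hq => hq.1))
    ((hb.contMDiffOn p.1 hp.1).comp p contMDiffWithinAt_fst (fun q hq => hq.1))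

end Smooth

/-! ### Calculus of matrix-valued functions -/

section MatrixCalculus
variable {ι : Type*} [Fintype ι]

theorem contDiffOn_matrix_mul {E : Type*} [NormedAddCommGroup E] [NormedSpace ℝ E]
    {m : WithTop ℕ∞} {A B : E → Matrix ι ι ℝ} {S : Set E}
    (hA : ∀ i j, ContDiffOn ℝ m (fun p => A p i j) S)
    (hB : ∀ i j, ContDiffOn ℝ m (fun p => B p i j) S) (i j : ι) :
    ContDiffOn ℝ m (fun p => (A p * B p) i j) S := by
  simp only [Matrix.mul_apply]
  exact ContDiffOn.sum fun k _ => (hA i k).mul (hB k j)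

theorem hasDerivAt_matrix_mul {A B : ℝ → Matrix ι ι ℝ} {A' B' : Matrix ι ι ℝ} {t : ℝ}
    (hA : ∀ i j, HasDerivAt (fun s => A s i j) (A' i j) t)
    (hB : ∀ i j, HasDerivAt (fun s => B s i j) (B' i j) t) (i j : ι) :
    HasDerivAt (fun s => (A s * B s) i j) ((A' * B t + A t * B') i j) t := by
  simp only [Matrix.mul_apply, Matrix.add_apply, ← Finset.sum_add_distrib]
  exact HasDerivAt.fun_sum fun k _ => (hA i k).mul (hB k j)

variable [DecidableEq ι]

theorem contDiffOn_det {E : Type*} [NormedAddCommGroup E] [NormedSpace ℝ E] {m : WithTop ℕ∞}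
    {A : E → Matrix ι ι ℝ} {S : Set E} (hA : ∀ i j, ContDiffOn ℝ m (fun p => A p i j) S) :
    ContDiffOn ℝ m (fun p => (A p).det) S := by
  simp only [Matrix.det_apply]
  refine ContDiffOn.sum fun σ _ => ?_
  simp only [Units.smul_def, zsmul_eq_mul]
  exact contDiffOn_const.mul (contDiffOn_prod fun i _ => hA _ _)

theorem contDiffOn_inv {E : Type*} [NormedAddCommGroup E] [NormedSpace ℝ E] {m : WithTop ℕ∞}
    {A : E → Matrix ι ι ℝ} {S : Set E} (hA : ∀ i j, ContDiffOn ℝ m (fun p => A p i j) S)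
    (hdet : ∀ p ∈ S, (A p).det ≠ 0) (i j : ι) : ContDiffOn ℝ m (fun p => (A p)⁻¹ i j) S := by
  simp only [Matrix.inv_def, Ring.inverse_eq_inv', Matrix.smul_apply, smul_eq_mul,
    Matrix.adjugate_apply]
  refine ((contDiffOn_det hA).inv hdet).mul (contDiffOn_det fun k l => ?_)
  by_cases hk : k = j
  · subst hk
    simpa using contDiffOn_const
  · simpa [Matrix.updateRow_ne hk] using hA k l

theorem hasDerivAt_inv_add_smul {G : Matrix ι ι ℝ} (hG : G.det ≠ 0) (K : Matrix ι ι ℝ) (i j : ι) :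
    HasDerivAt (fun s : ℝ => (G + s • K)⁻¹ i j) ((-(G⁻¹ * K * G⁻¹)) i j) 0 := by
  have hA : ∀ i j, ContDiff ℝ 1 (fun s : ℝ => (G + s • K) i j) := fun i j => by
    simp only [Matrix.add_apply, Matrix.smul_apply, smul_eq_mul]
    fun_prop
  have hA' : ∀ i j, HasDerivAt (fun s : ℝ => (G + s • K) i j) (K i j) 0 := fun i j => by
    simpa [Matrix.add_apply, Matrix.smul_apply] using
      ((hasDerivAt_id (0 : ℝ)).mul_const (K i j)).const_add (G i j)
  have hdc : Continuous fun s : ℝ => (G + s • K).det :=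
    (contDiffOn_univ.1 (contDiffOn_det fun i j => (hA i j).contDiffOn)).continuous
  have hopen : IsOpen {s : ℝ | (G + s • K).det ≠ 0} := isOpen_ne.preimage hdc
  have h0 : (0 : ℝ) ∈ {s : ℝ | (G + s • K).det ≠ 0} := by simpa using hG
  have hD : ∀ i j, HasDerivAt (fun s : ℝ => (G + s • K)⁻¹ i j)
      ((Matrix.of fun i j => deriv (fun s : ℝ => (G + s • K)⁻¹ i j) 0) i j) 0 := fun i j =>
    (((contDiffOn_inv (fun i j => (hA i j).contDiffOn) (fun p hp => hp) i j).contDiffAt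
      (hopen.mem_nhds h0)).differentiableAt one_ne_zero).hasDerivAt
  generalize (Matrix.of fun i j => deriv (fun s : ℝ => (G + s • K)⁻¹ i j) 0) = D at hD
  have hGu : IsUnit G.det := hG.isUnit
  -- differentiate the identity `(G + sK) (G + sK)⁻¹ = 1`
  have hz : K * G⁻¹ + G * D = 0 := by
    ext i j
    have h1 := hasDerivAt_matrix_mul hA' hD i j
    have h2 : HasDerivAt (fun s : ℝ => ((G + s • K) * (G + s • K)⁻¹) i j) 0 0 := by
      refine (hasDerivAt_const (0 : ℝ) ((1 : Matrix ι ι ℝ) i j)).congr_of_eventuallyEq ?_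
      filter_upwards [hopen.mem_nhds h0] with s hs
      rw [Matrix.mul_nonsing_inv _ (IsUnit.mk0 _ hs)]
    simpa using h1.unique h2
  have : D = -(G⁻¹ * K * G⁻¹) := by
    have h3 := congrArg (G⁻¹ * ·) hz
    simp only [Matrix.mul_add, Matrix.nonsing_inv_mul_cancel_left G _ hGu, mul_zero] at h3
    rw [Matrix.mul_assoc]
    exact eq_neg_of_add_eq_zero_right h3
  rw [← this]
  exact hD i j

/-- Jacobi's formula for the derivative of the determinant along a line. -/
theorem hasDerivAt_det_add_smul {G : Matrix ι ι ℝ} (hG : G.det ≠ 0) (K : Matrix ι ι ℝ) :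
    HasDerivAt (fun s : ℝ => (G + s • K).det) (G.det * (G⁻¹ * K).trace) 0 := by
  have hG' : IsUnit G.det := hG.isUnit
  have e : (fun s : ℝ => (G + s • K).det) = fun s => G.det * (Polynomial.eval s
      (Matrix.det (1 + (Polynomial.X : Polynomial ℝ) • (G⁻¹ * K).map Polynomial.C))) := by
    funext s
    rw [← Polynomial.coe_evalRingHom, RingHom.map_det, ← Matrix.det_mul]
    congr 1
    have : (Polynomial.evalRingHom s).mapMatrix
        (1 + (Polynomial.X : Polynomial ℝ) • (G⁻¹ * K).map Polynomial.C) = 1 + s • (G⁻¹ * K) := by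
      ext i j
      rw [RingHom.mapMatrix_apply, Matrix.map_apply, Matrix.add_apply, Matrix.smul_apply,
        Matrix.map_apply, Matrix.add_apply, Matrix.smul_apply, map_add, smul_eq_mul, map_mul]
      by_cases hij : i = j <;> simp [Matrix.one_apply, hij, -Matrix.map_mul]
    rw [this, mul_add, mul_one, Matrix.mul_smul, ← mul_assoc, Matrix.mul_nonsing_inv _ hG',
      one_mul]
  rw [e]
  have := (Polynomial.hasDerivAt
    (Matrix.det (1 + (Polynomial.X : Polynomial ℝ) • (G⁻¹ * K).map Polynomial.C))
    (0 : ℝ)).const_mul G.det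
  rwa [Matrix.derivative_det_one_add_X_smul] at this

/-- The pointwise computation behind the geodesic equation: the integrand
`Tr(g⁻¹ Q g⁻¹ G) √det g` along `g = r G + s K`, for `Q` that is a multiple of `G` at `s = 0`. The
term `Tr(g⁻¹ G g⁻¹ K)` comes from the two inverses (`-2`) and from the determinant (half the size
of the matrix). -/
theorem hasDerivAt_trace_mul_sqrt_det {G : Matrix ι ι ℝ}
    (hG : 0 < G.det) (K : Matrix ι ι ℝ) {r p : ℝ} (hr : 0 < r) {Q : ℝ → Matrix ι ι ℝ}
    {Q' : Matrix ι ι ℝ} (hQ : ∀ i j, HasDerivAt (fun s => Q s i j) (Q' i j) 0) (hQ0 : Q 0 = p • G) :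
    HasDerivAt (fun s : ℝ => ((r • G + s • K)⁻¹ * Q s * (r • G + s • K)⁻¹ * G).trace
        * √(r • G + s • K).det)
      ((((r • G)⁻¹ * Q' * (r • G)⁻¹ * G).trace
        + p * ((Fintype.card ι : ℝ) / 2 - 2) / r * ((r • G)⁻¹ * G * (r • G)⁻¹ * K).trace)
        * √(r • G).det) 0 := by
  have hd : 0 < (r • G).det := by rw [Matrix.det_smul]; positivity
  have h1 := hasDerivAt_inv_add_smul hd.ne' K
  have h2 := hasDerivAt_det_add_smul hd.ne' K
  have h3 := hasDerivAt_matrix_mul (hasDerivAt_matrix_mul (hasDerivAt_matrix_mul h1 hQ) h1)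
    (B := fun _ => G) (B' := 0) (fun i j => hasDerivAt_const _ _)
  have h4 : HasDerivAt (fun s : ℝ => ((r • G + s • K)⁻¹ * Q s * (r • G + s • K)⁻¹ * G).trace)
      _ 0 := HasDerivAt.fun_sum fun i (_ : i ∈ Finset.univ) => h3 i i
  have hd0 : (r • G + (0:ℝ) • K).det ≠ 0 := by simpa using hd.ne'
  have h5 := h4.mul (h2.sqrt hd0)
  refine h5.congr_deriv ?_
  have hGu : IsUnit G.det := hG.ne'.isUnit
  have hinv : (r • G)⁻¹ = r⁻¹ • G⁻¹ := by
    apply Matrix.inv_eq_right_inv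
    rw [smul_mul_smul_comm, mul_inv_cancel₀ hr.ne', Matrix.mul_nonsing_inv _ hGu, one_smul]
  have hs : √(r • G).det * √(r • G).det = (r • G).det := Real.mul_self_sqrt hd.le
  have hsp : 0 < √(r • G).det := Real.sqrt_pos.2 hd
  have e1 : G⁻¹ * G = 1 := Matrix.nonsing_inv_mul _ hGu
  have htr : ∀ X : Matrix ι ι ℝ, ∑ i, X i i = X.trace := fun X => rfl
  simp only [zero_smul, add_zero, hQ0, htr]
  generalize √(r • G).det = σ at *
  rw [← hs, hinv]
  simp only [Matrix.add_mul, Matrix.mul_assoc, e1, Matrix.trace_add, Matrix.trace_neg,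
    Matrix.trace_smul, Matrix.trace_one, mul_zero, add_zero, Matrix.smul_mul, Matrix.mul_smul,
    Matrix.neg_mul, Matrix.mul_neg, smul_eq_mul, mul_one, Matrix.one_mul]
  field_simp
  ring

end MatrixCalculus

/-! ### Gram matrices in frames -/

section Frames
theorem linearIndependent_stdVec {n : ℕ} : LinearIndependent ℝ (stdVec : Fin n → Model n) := by
  have e : (stdVec : Fin n → Model n) = (EuclideanSpace.basisFun (Fin n) ℝ).toBasis := by
    ext i
    simp [stdVec]
  rw [e]
  exact (EuclideanSpace.basisFun (Fin n) ℝ).toBasis.linearIndependent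

theorem linearIndependent_stdFrame {n : ℕ} {M : Type*} [TopologicalSpace M]
    [ChartedSpace (Model n) M] (x : M) : LinearIndependent ℝ (stdFrame (n := n) x) :=
  linearIndependent_stdVec

theorem exists_sum_smul_eq_of_linearIndependent {n : ℕ} {M : Type*} [TopologicalSpace M]
    [ChartedSpace (Model n) M] {x : M}
    {w : Fin n → TangentSpace (𝓡 n) x} (hw : LinearIndependent ℝ w) (u : TangentSpace (𝓡 n) x) :
    ∃ a : Fin n → ℝ, ∑ i, a i • w i = u := by
  have key : ∀ w : Fin n → Model n, LinearIndependent ℝ w → ∀ u : Model n,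
      ∃ a : Fin n → ℝ, ∑ i, a i • w i = u := fun w hw u => by
    rw [← Submodule.mem_span_range_iff_exists_fun ℝ,
      LinearIndependent.span_eq_top_of_card_eq_finrank' hw (by simp)]
    exact Submodule.mem_top
  exact key w hw u

variable {n : ℕ} {M : Type*} [TopologicalSpace M] [ChartedSpace (Model n) M]
  [IsManifold (𝓡 n) ∞ M]

theorem frameMatrix_smul {x : M} (w : Fin n → TangentSpace (𝓡 n) x) (c : ℝ) (h : SymTensor n M) :
    frameMatrix w ((c • h).raw x) = c • frameMatrix w (h.raw x) := rfl

theorem frameMatrix_add {x : M} (w : Fin n → TangentSpace (𝓡 n) x) (h k : SymTensor n M) :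
    frameMatrix w ((h + k).raw x) = frameMatrix w (h.raw x) + frameMatrix w (k.raw x) := rfl

theorem dotProduct_frameMatrix_mulVec {x : M} (w : Fin n → TangentSpace (𝓡 n) x)
    (h : SymTensor n M) (a b : Fin n → ℝ) :
    a ⬝ᵥ (frameMatrix w (h.raw x)).mulVec b = h.1 x (∑ i, a i • w i) (∑ j, b j • w j) := by
  have key : ∀ (β : Model n →L[ℝ] Model n →L[ℝ] ℝ) (w : Fin n → Model n),
      a ⬝ᵥ (Matrix.of fun i j => β (w i) (w j)).mulVec b = β (∑ i, a i • w i) (∑ j, b j • w j) := by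
    intro β w
    simp only [dotProduct, Matrix.mulVec, Matrix.of_apply, map_sum, map_smul, _root_.sum_apply,
      _root_.smul_apply, smul_eq_mul, Finset.mul_sum]
    rw [Finset.sum_comm]
    exact Finset.sum_congr rfl fun i _ => Finset.sum_congr rfl fun j _ => by ring
  exact key (h.1 x) w

theorem posDef_frameMatrix {g : SymTensor n M} (hg : g ∈ riemannianMetrics n M) {x : M}
    {w : Fin n → TangentSpace (𝓡 n) x} (hw : LinearIndependent ℝ w) :
    (frameMatrix w (g.raw x)).PosDef := by
  refine Matrix.PosDef.of_dotProduct_mulVec_pos ?_ fun a ha => ?_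
  · ext i j
    exact g.2 x _ _
  · rw [star_trivial, dotProduct_frameMatrix_mulVec]
    refine hg x _ fun h0 => ha ?_
    funext i
    exact Fintype.linearIndependent_iff.1 hw a h0 i

theorem linearIndependent_coordFrame (c : M) {y : Model n} (hy : y ∈ (extChartAt (𝓡 n) c).target) :
    LinearIndependent ℝ (coordFrame c y) := by
  have hinv := isInvertible_mfderivWithin_extChartAt_symm (I := 𝓡 n) hy
  rw [ModelWithCorners.range_eq_univ, mfderivWithin_univ] at hinv
  obtain ⟨e, he⟩ := hinv
  have := (linearIndependent_stdVec (n := n)).map' e.toLinearEquiv.toLinearMap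
    e.toLinearEquiv.ker
  have he' : ∀ v : Model n, e v =
      mfderiv 𝓘(ℝ, Model n) (𝓡 n) (extChartAt (𝓡 n) c).symm y v := fun v => by rw [← he]; rfl
  have he'' : coordFrame c y = ⇑(e.toLinearEquiv.toLinearMap) ∘ stdVec :=
    funext fun i => (he' (stdVec i)).symm
  rw [he'']
  exact this

/-- Gram matrices transform by congruence under a change of frame. -/
theorem exists_frameMatrix_eq_transpose_mul_mul {x : M} {w : Fin n → TangentSpace (𝓡 n) x}
    (hw : LinearIndependent ℝ w) :
    ∃ B : Matrix (Fin n) (Fin n) ℝ, IsUnit B.det ∧ ∀ h : SymTensor n M,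
      frameMatrix w (h.raw x) = B.transpose * frameMatrix (stdFrame x) (h.raw x) * B := by
  let w' : Fin n → Model n := w
  have hexp : ∀ i, w i = ∑ k, (w' i) k • stdFrame (n := n) x k := fun i => by
    have := (EuclideanSpace.basisFun (Fin n) ℝ).sum_repr (w' i)
    simp only [EuclideanSpace.basisFun_repr, EuclideanSpace.basisFun_apply] at this
    exact this.symm
  refine ⟨Matrix.of fun k i => (w' i) k, ?_, fun h => ?_⟩
  · rw [← Matrix.isUnit_iff_isUnit_det, ← Matrix.linearIndependent_cols_iff_isUnit]
    have := LinearIndependent.map' (v := w') hw (WithLp.linearEquiv 2 ℝ (Fin n → ℝ)).toLinearMap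
      (LinearEquiv.ker _)
    exact this
  · ext i j
    have h1 := dotProduct_frameMatrix_mulVec (stdFrame (n := n) x) h (fun k => (w' i) k)
      (fun k => (w' j) k)
    rw [← hexp, ← hexp] at h1
    rw [Matrix.mul_assoc, Matrix.mul_apply]
    exact h1.symm

/-- `Tr(g⁻¹ h g⁻¹ k)` may be computed in any frame. -/
theorem fibreInner_eq_trace {g : SymTensor n M} (h k : SymTensor n M) {x : M}
    {w : Fin n → TangentSpace (𝓡 n) x} (hw : LinearIndependent ℝ w) :
    fibreInner g h.raw k.raw x =
      ((frameMatrix w (g.raw x))⁻¹ * frameMatrix w (h.raw x) * (frameMatrix w (g.raw x))⁻¹ *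
        frameMatrix w (k.raw x)).trace := by
  obtain ⟨B, hB, hw⟩ := exists_frameMatrix_eq_transpose_mul_mul hw
  have hBt : IsUnit B.transpose.det := by rwa [Matrix.det_transpose]
  simp only [hw, fibreInner, Matrix.mul_inv_rev, Matrix.mul_assoc,
    Matrix.nonsing_inv_mul_cancel_left _ _ hBt, Matrix.mul_nonsing_inv_cancel_left _ _ hB]
  rw [Matrix.trace_mul_comm B⁻¹]
  simp only [Matrix.mul_assoc, Matrix.mul_nonsing_inv _ hB, Matrix.mul_one]

theorem fibreInner_comm (g : SymTensor n M) (h k : RawTensor n M) (x : M) :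
    fibreInner g h k x = fibreInner g k h x := by
  simp only [fibreInner]
  rw [Matrix.mul_assoc, Matrix.trace_mul_comm, Matrix.mul_assoc, Matrix.mul_assoc, Matrix.mul_assoc]

/-- `vol(g)` on a frame `w` is a multiple, independent of `g`, of `vol(g)` on the standard frame. -/
theorem exists_volDensity_eq {x : M} {w : Fin n → TangentSpace (𝓡 n) x}
    (hw : LinearIndependent ℝ w) :
    ∃ b : ℝ, ∀ g : SymTensor n M,
      volDensity g x w = b * √(frameMatrix (stdFrame x) (g.raw x)).det := by
  obtain ⟨B, -, hB⟩ := exists_frameMatrix_eq_transpose_mul_mul hw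
  refine ⟨|B.det|, fun g => ?_⟩
  rw [volDensity, hB, Matrix.det_mul, Matrix.det_mul, Matrix.det_transpose,
    mul_right_comm, ← sq, Real.sqrt_mul (sq_nonneg _), Real.sqrt_sq_eq_abs]

/-- The integrand of the `L²` inner product is smooth in time and in the coordinates. The fibre
inner product is defined with the standard frames of the tangent spaces, which need not vary
continuously with the point; it is rewritten in the coordinate frame. -/
theorem contDiffOn_fibreInner_mul_volDensity {J : Set ℝ} {c h k : ℝ → SymTensor n M}
    (hc : IsSmoothCurveOn J c) (hh : IsSmoothCurveOn J h) (hk : IsSmoothCurveOn J k)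
    (hm : ∀ t ∈ J, c t ∈ riemannianMetrics n M) (x₀ : M) :
    ContDiffOn ℝ ∞ (fun p : ℝ × Model n =>
      fibreInner (c p.1) (h p.1).raw (k p.1).raw ((extChartAt (𝓡 n) x₀).symm p.2) *
        volDensity (c p.1) ((extChartAt (𝓡 n) x₀).symm p.2) (coordFrame x₀ p.2))
      (J ×ˢ (extChartAt (𝓡 n) x₀).target) := by
  have hpos : ∀ p ∈ J ×ˢ (extChartAt (𝓡 n) x₀).target, 0 < (frameMatrix (coordFrame x₀ p.2)
      ((c p.1).raw ((extChartAt (𝓡 n) x₀).symm p.2))).det := fun p hp =>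
    (posDef_frameMatrix (hm _ hp.1) (linearIndependent_coordFrame x₀ hp.2)).det_pos
  have hG := hc.contDiffOn_coordFrame x₀
  have hI := contDiffOn_inv hG (fun p hp => (hpos p hp).ne')
  have h1 := contDiffOn_matrix_mul (contDiffOn_matrix_mul (contDiffOn_matrix_mul hI
    (hh.contDiffOn_coordFrame x₀)) hI) (hk.contDiffOn_coordFrame x₀)
  have h2 := (contDiffOn_det hG).sqrt (fun p hp => (hpos p hp).ne')
  refine (ContDiffOn.mul (ContDiffOn.sum fun i (_ : i ∈ Finset.univ) => h1 i i) h2).congr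
    fun p hp => ?_
  rw [fibreInner_eq_trace _ _ (linearIndependent_coordFrame x₀ hp.2)]
  rfl

end Frames

/-! ### Differentiation of integrals of densities -/

open MeasureTheory

/-- Differentiation under the integral over an open set, for a `C¹` family of functions that vanish
outside a fixed compact subset. -/
theorem hasDerivAt_setIntegral_of_contDiffOn {E : Type*} [NormedAddCommGroup E] [NormedSpace ℝ E]
    [FiniteDimensional ℝ E] [MeasurableSpace E] [BorelSpace E] {μ : Measure E}
    [IsFiniteMeasureOnCompacts μ] {U K : Set E} (hU : IsOpen U) (hK : IsCompact K) (hKU : K ⊆ U)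
    {F : ℝ → E → ℝ} {F' : E → ℝ}
    (hF : ContDiffOn ℝ 1 (fun p : ℝ × E => F p.1 p.2) (univ ×ˢ U))
    (hF0 : ∀ s, ∀ y ∈ U \ K, F s y = 0)
    (hF' : ∀ y ∈ U, HasDerivAt (fun s => F s y) (F' y) 0) :
    IntegrableOn F' U μ ∧ HasDerivAt (fun s => ∫ y in U, F s y ∂μ) (∫ y in U, F' y ∂μ) 0 := by
  have hKm := hK.measurableSet
  have hUo : IsOpen ((univ : Set ℝ) ×ˢ U) := isOpen_univ.prod hU
  -- the partial derivative in the parameter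
  let D : ℝ → E → ℝ := fun s y => fderiv ℝ (fun p : ℝ × E => F p.1 p.2) (s, y) (1, 0)
  have hD : ∀ s, ∀ y ∈ U, HasDerivAt (fun s => F s y) (D s y) s := fun s y hy => by
    have h1 := ((hF.contDiffAt (hUo.mem_nhds
      (show (s, y) ∈ univ ×ˢ U from ⟨mem_univ s, hy⟩))).differentiableAt
      one_ne_zero).hasFDerivAt
    exact h1.comp_hasDerivAt s ((hasDerivAt_id s).prodMk (hasDerivAt_const s y))
  have hDc : ContinuousOn (fun p : ℝ × E => D p.1 p.2) (univ ×ˢ U) :=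
    (hF.continuousOn_fderiv_of_isOpen hUo le_rfl).clm_apply continuousOn_const
  have hDD : ∀ y ∈ U, D 0 y = F' y := fun y hy => (hD 0 y hy).unique (hF' y hy)
  have hFK : ∀ s, ContinuousOn (F s) K := fun s =>
    hF.continuousOn.comp (Continuous.prodMk_right s).continuousOn fun y hy => ⟨mem_univ _, hKU hy⟩
  have hDK : ContinuousOn (D 0) K :=
    hDc.comp (Continuous.prodMk_right (0 : ℝ)).continuousOn fun y hy => ⟨mem_univ _, hKU hy⟩
  obtain ⟨C, hC⟩ := ((isCompact_Icc (a := (-1 : ℝ)) (b := 1)).prod hK).exists_bound_of_continuousOn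
    (hDc.mono (prod_mono (subset_univ _) hKU))
  have hmain := hasDerivAt_integral_of_dominated_loc_of_deriv_le (μ := μ.restrict K) (F := F)
    (F' := D) (x₀ := (0 : ℝ)) (bound := fun _ => C) (s := Icc (-1) 1)
    (Icc_mem_nhds (by norm_num) (by norm_num))
    (Eventually.of_forall fun s => (hFK s).aestronglyMeasurable hKm)
    ((hFK 0).integrableOn_compact hK) (hDK.aestronglyMeasurable hKm)
    ((ae_restrict_iff' hKm).2 (Eventually.of_forall fun y hy s hs => hC (s, y) ⟨hs, hy⟩))
    (integrableOn_const hK.measure_lt_top.ne)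
    ((ae_restrict_iff' hKm).2 (Eventually.of_forall fun y hy s _ => hD s y (hKU hy)))
  have hF'0 : ∀ y ∈ U \ K, F' y = 0 := fun y hy => by
    have h1 := hF' y hy.1
    simp only [hF0 _ y hy] at h1
    exact h1.unique (hasDerivAt_const _ _)
  constructor
  · have h2 : IntegrableOn F' K μ :=
      (integrableOn_congr_fun (fun y hy => hDD y (hKU hy)) hKm).1 hmain.1
    refine h2.of_forall_sdiff_eq_zero hU.measurableSet hF'0
  · have e1 : ∀ s, ∫ y in U, F s y ∂μ = ∫ y in K, F s y ∂μ := fun s =>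
      setIntegral_eq_of_subset_of_forall_sdiff_eq_zero hU.measurableSet hKU (hF0 s)
    have e2 : ∫ y in U, F' y ∂μ = ∫ y in K, D 0 y ∂μ := by
      rw [setIntegral_eq_of_subset_of_forall_sdiff_eq_zero hU.measurableSet hKU hF'0]
      exact setIntegral_congr_fun hKm fun y hy => (hDD y (hKU hy)).symm
    simp only [e1, e2]
    exact hmain.2

section Integral
variable {n : ℕ} {M : Type*} [TopologicalSpace M] [ChartedSpace (Model n) M]
  [IsManifold (𝓡 n) ∞ M] [CompactSpace M] [T2Space M]

/-- The part of a density in the chart around `c`, in coordinates: its coefficient multiplied by the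
function of the partition of unity attached to `c`. -/
noncomputable def localDensity (μ : Density n M) (c : M) (y : Model n) : ℝ :=
  chartPartition n M c ((extChartAt (𝓡 n) c).symm y) *
    μ ((extChartAt (𝓡 n) c).symm y) (coordFrame c y)

/-- A density is integrable if it is integrable in the charts that enter `integralDensity`. -/
def DensityIntegrable (μ : Density n M) : Prop :=
  ∀ c : M, IntegrableOn (localDensity μ c) (extChartAt (𝓡 n) c).target

variable (n M) in
theorem exists_finset_integralDensity_eq_sum : ∃ S : Finset M, ∀ μ : Density n M,
    integralDensity μ = ∑ c ∈ S, ∫ y in (extChartAt (𝓡 n) c).target, localDensity μ c y := by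
  have hfin := LocallyFinite.finite_nonempty_of_compact (chartPartition n M).locallyFinite
  refine ⟨hfin.toFinset, fun μ => finsum_eq_sum_of_support_subset _ fun c hc => ?_⟩
  rw [Finite.coe_toFinset]
  by_contra hne
  have h0 : ∀ x, chartPartition n M c x = 0 := fun x => by
    by_contra hx
    exact hne ⟨x, hx⟩
  refine hc ?_
  simp [h0]

theorem integralDensity_add {μ ν : Density n M} (hμ : DensityIntegrable μ)
    (hν : DensityIntegrable ν) :
    integralDensity (fun x w => μ x w + ν x w) = integralDensity μ + integralDensity ν := by
  obtain ⟨S, hS⟩ := exists_finset_integralDensity_eq_sum n M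
  rw [hS, hS, hS, ← Finset.sum_add_distrib]
  refine Finset.sum_congr rfl fun c _ => ?_
  rw [← integral_add (hμ c) (hν c)]
  simp only [localDensity, mul_add]

theorem integralDensity_const_mul (a : ℝ) (μ : Density n M) :
    integralDensity (fun x w => a * μ x w) = a * integralDensity μ := by
  obtain ⟨S, hS⟩ := exists_finset_integralDensity_eq_sum n M
  rw [hS, hS, Finset.mul_sum]
  refine Finset.sum_congr rfl fun c _ => ?_
  rw [← integral_const_mul]
  simp only [localDensity, mul_left_comm a]

theorem DensityIntegrable.const_mul {μ : Density n M} (hμ : DensityIntegrable μ) (a : ℝ) :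
    DensityIntegrable (fun x w => a * μ x w) := fun c => by
  have := (hμ c).const_mul a
  refine this.congr (Eventually.of_forall fun y => ?_)
  simp only [localDensity]
  ring

theorem DensityIntegrable.sub {μ ν : Density n M} (hμ : DensityIntegrable μ)
    (hν : DensityIntegrable ν) : DensityIntegrable (fun x w => μ x w - ν x w) := fun c => by
  have := (hμ c).sub (hν c)
  refine this.congr (Eventually.of_forall fun y => ?_)
  simp only [localDensity, Pi.sub_apply]
  ring

/-- The derivative of an integral over the closed manifold of a smooth family of densities is the
integral of the derivative. -/
theorem hasDerivAt_integralDensity {μ : ℝ → Density n M} {μ' : Density n M}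
    (hμ : ∀ c : M, ContDiffOn ℝ ∞ (fun p : ℝ × Model n =>
      μ p.1 ((extChartAt (𝓡 n) c).symm p.2) (coordFrame c p.2))
      (univ ×ˢ (extChartAt (𝓡 n) c).target))
    (hμ' : ∀ (x : M) (w : Fin n → TangentSpace (𝓡 n) x), LinearIndependent ℝ w →
      HasDerivAt (fun s => μ s x w) (μ' x w) 0) :
    DensityIntegrable μ' ∧
      HasDerivAt (fun s => integralDensity (μ s)) (integralDensity μ') 0 := by
  obtain ⟨S, hS⟩ := exists_finset_integralDensity_eq_sum n M
  have key : ∀ c : M, IntegrableOn (localDensity μ' c) (extChartAt (𝓡 n) c).target ∧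
      HasDerivAt (fun s => ∫ y in (extChartAt (𝓡 n) c).target, localDensity (μ s) c y)
        (∫ y in (extChartAt (𝓡 n) c).target, localDensity μ' c y) 0 := fun c => by
    have hopen := isOpen_extChartAt_target (I := 𝓡 n) c
    have hsub : tsupport (chartPartition n M c) ⊆ (extChartAt (𝓡 n) c).source := by
      rw [extChartAt_source]
      exact Classical.choose_spec
        (SmoothPartitionOfUnity.exists_isSubordinate_chartAt_source (𝓡 n) M) c
    have hρ : ContDiffOn ℝ ∞ (fun y => chartPartition n M c ((extChartAt (𝓡 n) c).symm y))
        (extChartAt (𝓡 n) c).target :=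
      ((chartPartition n M c).contMDiff.comp_contMDiffOn
        (contMDiffOn_extChartAt_symm c)).contDiffOn
    refine hasDerivAt_setIntegral_of_contDiffOn (K := extChartAt (𝓡 n) c ''
      tsupport (chartPartition n M c)) hopen ?_ ?_ ?_ ?_ ?_
    · exact (isClosed_tsupport _).isCompact.image_of_continuousOn
        ((continuousOn_extChartAt c).mono hsub)
    · rintro _ ⟨x, hx, rfl⟩
      exact (extChartAt (𝓡 n) c).map_source (hsub hx)
    · exact ((hρ.comp contDiffOn_snd fun p hp => hp.2).mul (hμ c)).of_le
        (by exact_mod_cast le_top)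
    · rintro s y ⟨hy, hyK⟩
      have : chartPartition n M c ((extChartAt (𝓡 n) c).symm y) = 0 := by
        by_contra hne
        exact hyK ⟨_, subset_tsupport _ hne, (extChartAt (𝓡 n) c).right_inv hy⟩
      simp only [localDensity, this, zero_mul]
    · exact fun y hy => (hμ' _ _ (linearIndependent_coordFrame c hy)).const_mul _
  refine ⟨fun c => (key c).1, ?_⟩
  simp only [hS]
  exact HasDerivAt.fun_sum fun c _ => (key c).2

theorem densityIntegrable_of_contDiffOn {μ : Density n M}
    (hμ : ∀ c : M, ContDiffOn ℝ ∞ (fun p : ℝ × Model n =>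
      μ ((extChartAt (𝓡 n) c).symm p.2) (coordFrame c p.2))
      (univ ×ˢ (extChartAt (𝓡 n) c).target)) : DensityIntegrable μ :=
  (hasDerivAt_integralDensity (μ := fun s x w => s * μ x w)
    (fun c => contDiffOn_fst.mul (hμ c)) (fun x w _ => by
      simpa using (hasDerivAt_id (0 : ℝ)).mul_const (μ x w))).1

end Integral

/-! ### Metrics near a metric -/

section Metrics
variable {n : ℕ} {M : Type*} [TopologicalSpace M] [ChartedSpace (Model n) M]
  [IsManifold (𝓡 n) ∞ M]

theorem isSmoothCurveOn_const (J : Set ℝ) (h : SymTensor n M) :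
    IsSmoothCurveOn J (fun _ => h) := by
  simpa using isSmoothCurveOn_smul_add_smul (J := J) (contDiffOn_const (c := (1 : ℝ)))
    (contDiffOn_const (c := (0 : ℝ))) h 0

theorem isSmoothCurveOn_smul {J : Set ℝ} {a : ℝ → ℝ} (ha : ContDiffOn ℝ ∞ a J)
    (h : SymTensor n M) : IsSmoothCurveOn J (fun t => a t • h) := by
  simpa using isSmoothCurveOn_smul_add_smul ha (contDiffOn_const (c := (0 : ℝ))) h 0

theorem smul_mem_riemannianMetrics {g : SymTensor n M} (hg : g ∈ riemannianMetrics n M) {r : ℝ}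
    (hr : 0 < r) : r • g ∈ riemannianMetrics n M := fun x u hu => mul_pos hr (hg x u hu)

/-- Being a metric is an open condition along a line of tensor fields; this is where compactness of
the manifold enters. -/
theorem eventually_add_smul_mem_riemannianMetrics [CompactSpace M] {g : SymTensor n M}
    (hg : g ∈ riemannianMetrics n M) (k : SymTensor n M) :
    ∀ᶠ s in 𝓝 (0 : ℝ), g + s • k ∈ riemannianMetrics n M := by
  have hloc : ∀ x₀ : M, ∀ᶠ z : ℝ × M in 𝓝 (0, x₀),
      ∀ u : TangentSpace (𝓡 n) z.2, u ≠ 0 → 0 < (g + z.1 • k).1 z.2 u u := by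
    intro x₀
    have hopen := isOpen_extChartAt_target (I := 𝓡 n) x₀
    let Φ : ℝ × Model n → Matrix (Fin n) (Fin n) ℝ := fun p => frameMatrix (coordFrame x₀ p.2)
      ((g + p.1 • k).raw ((extChartAt (𝓡 n) x₀).symm p.2))
    have hcurve : IsSmoothCurveOn univ fun s : ℝ => g + s • k := by
      simpa using isSmoothCurveOn_smul_add_smul (J := univ) (contDiffOn_const (c := (1 : ℝ)))
        contDiffOn_id g k
    have hΦ : ∀ i j, ContinuousOn (fun p => Φ p i j) (univ ×ˢ (extChartAt (𝓡 n) x₀).target) :=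
      fun i j => (hcurve.contDiffOn_coordFrame x₀ i j).continuousOn
    have hy₀ := mem_extChartAt_target (I := 𝓡 n) x₀
    have hmem : univ ×ˢ (extChartAt (𝓡 n) x₀).target ∈ 𝓝 ((0 : ℝ), extChartAt (𝓡 n) x₀ x₀) :=
      (isOpen_univ.prod hopen).mem_nhds ⟨mem_univ _, hy₀⟩
    -- positivity of a quadratic form need only be tested on the unit sphere, which is compact
    have h1 : ∀ᶠ p : ℝ × Model n in 𝓝 (0, extChartAt (𝓡 n) x₀ x₀),
        ∀ a ∈ Metric.sphere (0 : Fin n → ℝ) 1, 0 < a ⬝ᵥ (Φ p).mulVec a := by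
      refine (isCompact_sphere (0 : Fin n → ℝ) 1).eventually_forall_of_forall_eventually
        fun a ha => ?_
      have ha0 : a ≠ 0 := fun h => by simp [h] at ha
      have hcont : ContinuousAt (fun q : (ℝ × Model n) × (Fin n → ℝ) =>
          q.2 ⬝ᵥ (Φ q.1).mulVec q.2) ((0, extChartAt (𝓡 n) x₀ x₀), a) := by
        simp only [dotProduct, Matrix.mulVec]
        have hb : ∀ i, ContinuousAt (fun q : (ℝ × Model n) × (Fin n → ℝ) => q.2 i)
            ((0, extChartAt (𝓡 n) x₀ x₀), a) := fun i => by fun_prop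
        have hc : ∀ i j, ContinuousAt (fun q : (ℝ × Model n) × (Fin n → ℝ) => Φ q.1 i j)
            ((0, extChartAt (𝓡 n) x₀ x₀), a) := fun i j =>
          ContinuousAt.comp (f := Prod.fst) (g := fun p => Φ p i j)
            ((hΦ i j).continuousAt hmem) continuousAt_fst
        exact tendsto_finsetSum _ fun i _ => (hb i).mul
          (tendsto_finsetSum _ fun j _ => (hc i j).mul (hb j))
      have hpos : 0 < a ⬝ᵥ (Φ (0, extChartAt (𝓡 n) x₀ x₀)).mulVec a := by
        have hpd := posDef_frameMatrix hg (linearIndependent_coordFrame x₀ hy₀)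
        have := hpd.dotProduct_mulVec_pos ha0
        simpa [Φ] using this
      exact hcont.eventually (lt_mem_nhds hpos)
    have h2 : Tendsto (fun z : ℝ × M => (z.1, extChartAt (𝓡 n) x₀ z.2)) (𝓝 (0, x₀))
        (𝓝 (0, extChartAt (𝓡 n) x₀ x₀)) :=
      continuousAt_fst.prodMk (ContinuousAt.comp (f := Prod.snd) (g := extChartAt (𝓡 n) x₀)
        (continuousAt_extChartAt x₀) continuousAt_snd)
    have h3 : ∀ᶠ z : ℝ × M in 𝓝 (0, x₀), z.2 ∈ (extChartAt (𝓡 n) x₀).source :=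
      continuousAt_snd.eventually (extChartAt_source_mem_nhds x₀)
    filter_upwards [h2.eventually h1, h3] with z hz1 hz2
    have hzt := (extChartAt (𝓡 n) x₀).map_source hz2
    have hall : ∀ u : TangentSpace (𝓡 n) ((extChartAt (𝓡 n) x₀).symm (extChartAt (𝓡 n) x₀ z.2)),
        u ≠ 0 → 0 < (g + z.1 • k).1 _ u u := by
      intro u hu
      obtain ⟨a, ha⟩ := exists_sum_smul_eq_of_linearIndependent
        (linearIndependent_coordFrame x₀ hzt) u
      have ha0 : a ≠ 0 := by
        rintro rfl
        exact hu (ha.symm.trans (Finset.sum_eq_zero fun i _ => zero_smul ℝ _))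
      have hn : 0 < ‖a‖ := norm_pos_iff.2 ha0
      have h4 := hz1 (‖a‖⁻¹ • a) (by simp [norm_smul, hn.ne'])
      rw [Matrix.mulVec_smul, dotProduct_smul, smul_dotProduct, smul_smul] at h4
      have h5 := pos_of_mul_pos_right (smul_eq_mul (α := ℝ) _ _ ▸ h4) (by positivity)
      rwa [dotProduct_frameMatrix_mulVec, ha] at h5
    rwa [(extChartAt (𝓡 n) x₀).left_inv hz2] at hall
  have := (isCompact_univ (X := M)).eventually_forall_of_forall_eventually (x₀ := (0 : ℝ))
    (P := fun s x => ∀ u : TangentSpace (𝓡 n) x, u ≠ 0 → 0 < (g + s • k).1 x u u)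
    (fun x _ => hloc x)
  filter_upwards [this] with s hs x u hu using hs x (mem_univ x) u hu

/-- A line through a metric agrees near the metric with a smooth curve of metrics that is defined
for all times. -/
theorem exists_smooth_cutoff [CompactSpace M] {g : SymTensor n M}
    (hg : g ∈ riemannianMetrics n M) (k : SymTensor n M) :
    ∃ φ : ℝ → ℝ, ContDiff ℝ ∞ φ ∧ (∀ᶠ s in 𝓝 0, φ s = s) ∧
      ∀ s, g + φ s • k ∈ riemannianMetrics n M := by
  obtain ⟨ε, hε, hball⟩ := Metric.eventually_nhds_iff.1
    (eventually_add_smul_mem_riemannianMetrics hg k)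
  let f : ContDiffBump (0 : ℝ) := ⟨ε / 2, ε, half_pos hε, half_lt_self hε⟩
  refine ⟨fun s => s * f s, contDiff_id.mul f.contDiff, ?_, fun s => hball ?_⟩
  · filter_upwards [f.eventuallyEq_one] with s hs
    simp [hs]
  · rw [dist_zero_right, norm_mul, Real.norm_of_nonneg f.nonneg]
    by_cases hs : ε ≤ ‖s‖
    · have : f s = 0 := f.zero_of_le_dist (by simpa using hs)
      simpa [this] using hε
    · exact (mul_le_of_le_one_right (norm_nonneg _) f.le_one).trans_lt (not_le.1 hs)

end Metrics

/-! ### The inner product and the derivatives of the metric along the ray -/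

section Inner
variable {n : ℕ} {M : Type*} [TopologicalSpace M] [ChartedSpace (Model n) M]
  [IsManifold (𝓡 n) ∞ M] [CompactSpace M] [T2Space M]

theorem innerL2_comm (g : SymTensor n M) (h k : RawTensor n M) :
    innerL2 g h k = innerL2 g k h := by
  simp only [innerL2, fibreInner_comm g h k]

theorem innerL2_smul_left (g : SymTensor n M) (a : ℝ) (h : SymTensor n M) (k : RawTensor n M) :
    innerL2 g (a • h).raw k = a * innerL2 g h.raw k := by
  rw [innerL2, innerL2, ← integralDensity_const_mul]
  congr 1
  funext x w
  simp only [fibreInner, frameMatrix_smul, Matrix.mul_smul, Matrix.smul_mul, Matrix.trace_smul,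
    smul_eq_mul, mul_assoc]

theorem innerL2_smul_right (g : SymTensor n M) (a : ℝ) (h : RawTensor n M) (k : SymTensor n M) :
    innerL2 g h (a • k).raw = a * innerL2 g h k.raw := by
  rw [innerL2_comm, innerL2_smul_left, innerL2_comm]

theorem densityIntegrable_fibreInner_mul_volDensity {g : SymTensor n M}
    (hg : g ∈ riemannianMetrics n M) (h k : SymTensor n M) :
    DensityIntegrable fun x w => fibreInner g h.raw k.raw x * volDensity g x w :=
  densityIntegrable_of_contDiffOn fun c =>
    contDiffOn_fibreInner_mul_volDensity (isSmoothCurveOn_const univ g)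
      (isSmoothCurveOn_const univ h) (isSmoothCurveOn_const univ k) (fun _ _ => hg) c

theorem innerL2_add_left {g : SymTensor n M} (hg : g ∈ riemannianMetrics n M)
    (h₁ h₂ k : SymTensor n M) :
    innerL2 g (h₁ + h₂).raw k.raw = innerL2 g h₁.raw k.raw + innerL2 g h₂.raw k.raw := by
  simp only [innerL2]
  rw [← integralDensity_add (densityIntegrable_fibreInner_mul_volDensity hg h₁ k)
    (densityIntegrable_fibreInner_mul_volDensity hg h₂ k)]
  congr 1
  funext x w
  simp only [fibreInner, frameMatrix_add, Matrix.mul_add, Matrix.trace_add, add_mul]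

theorem innerL2_add_right {g : SymTensor n M} (hg : g ∈ riemannianMetrics n M)
    (h k₁ k₂ : SymTensor n M) :
    innerL2 g h.raw (k₁ + k₂).raw = innerL2 g h.raw k₁.raw + innerL2 g h.raw k₂.raw := by
  rw [innerL2_comm, innerL2_add_left hg, innerL2_comm g k₁.raw, innerL2_comm g k₂.raw]

/-- The `L²` inner product scales by `r ^ (n / 2 - 2)` when the metric is multiplied by `r`. -/
theorem innerL2_smul_metric {g : SymTensor n M} (hg : g ∈ riemannianMetrics n M) {r : ℝ}
    (hr : 0 < r) (h k : RawTensor n M) :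
    innerL2 (r • g) h k = √(r ^ n) / r ^ 2 * innerL2 g h k := by
  rw [innerL2, innerL2, ← integralDensity_const_mul]
  congr 1
  funext x w
  have hG : IsUnit (frameMatrix (stdFrame x) (g.raw x)).det :=
    (posDef_frameMatrix hg (linearIndependent_stdFrame x)).det_pos.ne'.isUnit
  have hinv : (r • frameMatrix (stdFrame x) (g.raw x))⁻¹ =
      r⁻¹ • (frameMatrix (stdFrame x) (g.raw x))⁻¹ := by
    apply Matrix.inv_eq_right_inv
    rw [smul_mul_smul_comm, mul_inv_cancel₀ hr.ne', Matrix.mul_nonsing_inv _ hG, one_smul]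
  simp only [fibreInner, volDensity, frameMatrix_smul, hinv, Matrix.det_smul, Fintype.card_fin,
    Matrix.mul_smul, Matrix.smul_mul, Matrix.trace_smul, smul_eq_mul]
  rw [Real.sqrt_mul (by positivity)]
  field_simp

variable {P : SymTensor n M → SymTensor n M →ₗ[ℝ] SymTensor n M}

/-- The inner product is non-degenerate: test the vanishing functional `⟨h, ·⟩` on the preimage of
`h` under `P_g`, which is a positive operator. -/
theorem eq_zero_of_forall_innerL2_eq_zero (hP : IsMetricOperator P) {g : SymTensor n M}
    (hg : g ∈ riemannianMetrics n M) {h : SymTensor n M}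
    (h0 : ∀ k : SymTensor n M, innerL2 g h.raw k.raw = 0) : h = 0 := by
  obtain ⟨k, rfl⟩ := (hP.bijective g hg).2 h
  by_contra hne
  have hk : k ≠ 0 := fun hk => hne (by rw [hk, map_zero])
  exact (hP.positive g hg k hk).ne' (h0 k)

theorem ext_innerL2 (hP : IsMetricOperator P) {g : SymTensor n M}
    (hg : g ∈ riemannianMetrics n M) {h₁ h₂ : SymTensor n M}
    (h : ∀ k : SymTensor n M, innerL2 g h₁.raw k.raw = innerL2 g h₂.raw k.raw) : h₁ = h₂ := by
  rw [← sub_eq_zero]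
  refine eq_zero_of_forall_innerL2_eq_zero hP hg fun k => ?_
  rw [sub_eq_add_neg, ← neg_one_smul ℝ h₂, innerL2_add_left hg, innerL2_smul_left, h]
  ring

theorem metricP_smul_smul (P : SymTensor n M → SymTensor n M →ₗ[ℝ] SymTensor n M)
    (g : SymTensor n M) (a b : ℝ) (h k : SymTensor n M) :
    metricP P g (a • h) (b • k) = a * b * metricP P g h k := by
  rw [metricP, map_smul, innerL2_smul_left, innerL2_smul_right, metricP, mul_assoc]

theorem derivMetricP_smul_smul (P : SymTensor n M → SymTensor n M →ₗ[ℝ] SymTensor n M)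
    (g m : SymTensor n M) (a b : ℝ) (h k : SymTensor n M) :
    derivMetricP P g m (a • h) (b • k) = a * b * derivMetricP P g m h k := by
  simp only [derivMetricP, metricP_smul_smul]
  rw [deriv_const_mul_field]

theorem derivMetricP_smul_direction (P : SymTensor n M → SymTensor n M →ₗ[ℝ] SymTensor n M)
    (g m : SymTensor n M) (a : ℝ) (h k : SymTensor n M) :
    derivMetricP P g (a • m) h k = a * derivMetricP P g m h k := by
  simp only [derivMetricP]
  have := deriv_comp_mul_left a (fun s : ℝ => metricP P (g + s • m) h k) 0
  simp only [mul_zero, smul_eq_mul] at this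
  rw [← this]
  simp only [smul_smul, mul_comm a]

/-- `D_{(g,k)} G^P(g₀,g₀)` for `g = r g₀`. Of the three factors of the integrand only `P_g` gives a
new term; the derivatives of `g⁻¹` and of `vol(g)` are multiples of `⟨g₀, k⟩` because `g` and
`P_g g₀` are multiples of `g₀`. -/
theorem derivMetricP_of_direction (hP : IsMetricOperator P) {g₀ : SymTensor n M}
    (hg₀ : g₀ ∈ riemannianMetrics n M) {r p : ℝ} (hr : 0 < r) (hp : P (r • g₀) g₀ = p • g₀)
    (k : SymTensor n M) :
    derivMetricP P (r • g₀) k g₀ g₀ =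
      innerL2 (r • g₀) (derivOperator P (r • g₀) k g₀) g₀.raw +
        p * ((n : ℝ) / 2 - 2) / r * innerL2 (r • g₀) g₀.raw k.raw := by
  have hg := smul_mem_riemannianMetrics hg₀ hr
  -- smoothness of `P` is about curves defined for all times, so the line `g + s k` is cut off
  obtain ⟨φ, hφ, hφ0, hφm⟩ := exists_smooth_cutoff hg k
  have hφz : φ 0 = 0 := hφ0.self_of_nhds
  let c : ℝ → SymTensor n M := fun s => r • g₀ + φ s • k
  have hc : IsSmoothCurveOn univ c := by
    have := isSmoothCurveOn_smul_add_smul (J := univ) (contDiffOn_const (c := (1 : ℝ)))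
      hφ.contDiffOn (r • g₀) k
    simpa only [one_smul] using this
  have hPc : IsSmoothCurveOn univ fun s => P (c s) g₀ :=
    hP.smooth c _ hc (isSmoothCurveOn_const univ g₀) hφm
  have hev : ∀ᶠ s in 𝓝 (0 : ℝ), c s = r • g₀ + s • k := by
    filter_upwards [hφ0] with s hs
    simp only [c, hs]
  let μ : ℝ → Density n M := fun s x w =>
    fibreInner (c s) (P (c s) g₀).raw g₀.raw x * volDensity (c s) x w
  let ν : Density n M := fun x w => p * ((n : ℝ) / 2 - 2) / r *
    (fibreInner (r • g₀) g₀.raw k.raw x * volDensity (r • g₀) x w)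
  let δ : Density n M := fun x w =>
    fibreInner (r • g₀) (derivOperator P (r • g₀) k g₀) g₀.raw x * volDensity (r • g₀) x w
  have hν : DensityIntegrable ν :=
    (densityIntegrable_fibreInner_mul_volDensity hg g₀ k).const_mul _
  have hμ : ∀ (x : M) (w : Fin n → TangentSpace (𝓡 n) x), LinearIndependent ℝ w →
      HasDerivAt (fun s => μ s x w) (δ x w + ν x w) 0 := by
    intro x w hw
    obtain ⟨b, hb⟩ := exists_volDensity_eq hw
    have hdet := (posDef_frameMatrix hg₀ (linearIndependent_stdFrame x)).det_pos
    have hQ : ∀ i j, HasDerivAt (fun s => frameMatrix (stdFrame x) ((P (c s) g₀).raw x) i j)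
        (frameMatrix (stdFrame x) (derivOperator P (r • g₀) k g₀ x) i j) 0 := fun i j => by
      have h1 := ((contDiffOn_univ.1 (hPc.contDiffOn_apply x (stdFrame x i)
        (stdFrame x j))).differentiable (by simp)).differentiableAt (x := 0) |>.hasDerivAt
      refine h1.congr_deriv ?_
      refine EventuallyEq.deriv_eq ?_
      filter_upwards [hev] with s hs
      rw [hs]
    have hQ0 : frameMatrix (stdFrame x) ((P (c 0) g₀).raw x) =
        p • frameMatrix (stdFrame x) (g₀.raw x) := by
      have : c 0 = r • g₀ := by simp [c, hφz]
      rw [this, hp, frameMatrix_smul]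
    have h2 := (hasDerivAt_trace_mul_sqrt_det hdet (frameMatrix (stdFrame x) (k.raw x)) hr hQ
      hQ0).const_mul b
    refine (h2.congr_of_eventuallyEq ?_).congr_deriv ?_
    · filter_upwards [hev] with s hs
      simp only [μ, hb, fibreInner]
      rw [hs]
      simp only [frameMatrix_add, frameMatrix_smul]
      ring
    · simp only [δ, ν, hb, fibreInner, frameMatrix_smul, Fintype.card_fin]
      ring
  have hsm := contDiffOn_fibreInner_mul_volDensity (c := c) (h := fun s => P (c s) g₀)
    (k := fun _ => g₀) hc hPc (isSmoothCurveOn_const univ g₀) (fun t _ => hφm t)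
  obtain ⟨hint, hder⟩ := hasDerivAt_integralDensity (μ := μ) (μ' := fun x w => δ x w + ν x w)
    hsm hμ
  have hδ : DensityIntegrable δ := by simpa using hint.sub hν
  rw [integralDensity_add hδ hν, integralDensity_const_mul] at hder
  refine HasDerivAt.deriv (hder.congr_of_eventuallyEq ?_)
  filter_upwards [hev] with s hs
  rw [← hs]
  rfl

/-- `D_{(g,g₀)} G^P(g₀,k)` for `g = r g₀`, by scaling. -/
theorem derivMetricP_of_ray {g₀ : SymTensor n M}
    (hg₀ : g₀ ∈ riemannianMetrics n M) {Ψ : ℝ → ℝ} (hΨ : ∀ r, 0 < r → P (r • g₀) g₀ = Ψ r • g₀)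
    {r : ℝ} (hr : 0 < r) (hd : DifferentiableAt ℝ Ψ r) (k : SymTensor n M) :
    derivMetricP P (r • g₀) g₀ g₀ k =
      (deriv Ψ r + ((n : ℝ) / 2 - 2) * Ψ r / r) * innerL2 (r • g₀) g₀.raw k.raw := by
  have h1 : HasDerivAt (fun s : ℝ => r + s) 1 0 := (hasDerivAt_id 0).const_add r
  have hpos : 0 < r ^ n := pow_pos hr n
  have h2 : HasDerivAt (fun ρ : ℝ => Ψ ρ * (√(ρ ^ n) / ρ ^ 2) * innerL2 g₀ g₀.raw k.raw)
      (((deriv Ψ r + ((n : ℝ) / 2 - 2) * Ψ r / r) * (√(r ^ n) / r ^ 2)) *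
        innerL2 g₀ g₀.raw k.raw) r := by
    have h3 := (hd.hasDerivAt.mul (((hasDerivAt_pow n r).sqrt hpos.ne').div
      (hasDerivAt_pow 2 r) (by positivity))).mul_const (innerL2 g₀ g₀.raw k.raw)
    refine h3.congr_deriv ?_
    simp only [Pi.div_apply]
    congr 1
    have hs : √(r ^ n) * √(r ^ n) = r ^ n := Real.mul_self_sqrt hpos.le
    have hsp : 0 < √(r ^ n) := Real.sqrt_pos.2 hpos
    have hn : (n : ℝ) * r ^ (n - 1) = n * (√(r ^ n) * √(r ^ n)) / r := by
      rcases Nat.eq_zero_or_pos n with rfl | hn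
      · simp
      · rw [hs, eq_div_iff hr.ne', mul_assoc, ← pow_succ, Nat.sub_add_cancel hn]
    rw [hn]
    generalize √(r ^ n) = σ at *
    field_simp
    push_cast
    ring
  have h3 := HasDerivAt.comp
    (h₂ := fun ρ : ℝ => Ψ ρ * (√(ρ ^ n) / ρ ^ 2) * innerL2 g₀ g₀.raw k.raw) (0 : ℝ)
    (by rw [add_zero]; exact h2) h1
  have h4 : (fun s : ℝ => metricP P (r • g₀ + s • g₀) g₀ k) =ᶠ[𝓝 0]
      (fun ρ : ℝ => Ψ ρ * (√(ρ ^ n) / ρ ^ 2) * innerL2 g₀ g₀.raw k.raw) ∘ fun s => r + s := by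
    have : ∀ᶠ s in 𝓝 (0 : ℝ), 0 < r + s :=
      h1.continuousAt.eventually (lt_mem_nhds (by simpa using hr))
    filter_upwards [this] with s hs
    rw [← add_smul, metricP, hΨ _ hs, innerL2_smul_left, innerL2_smul_metric hg₀ hs]
    simp only [Function.comp, mul_assoc]
  rw [derivMetricP, (h3.congr_of_eventuallyEq h4).deriv, innerL2_smul_metric hg₀ hr]
  ring

end Inner

/-! ### The differential equation for the scalar factor -/

/-- Local solvability of `r'' = r'² F(r)`. With `Φ' = F` and `W' = exp(-Φ)` the equation says that
`W(r(t))` is affine in `t`, so `r` is given by the inverse function of `W`. -/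
theorem exists_smooth_solution_of_deriv_deriv_eq {F : ℝ → ℝ} (hF : ContDiffOn ℝ ∞ F (Ioi 0))
    {r₀ : ℝ} (hr₀ : 0 < r₀) (a : ℝ) :
    ∃ ε > 0, ∃ r : ℝ → ℝ, ContDiffOn ℝ ∞ r (Ioo (-ε) ε) ∧ (∀ t ∈ Ioo (-ε) ε, 0 < r t) ∧
      r 0 = r₀ ∧ HasDerivAt r a 0 ∧
      ∀ t ∈ Ioo (-ε) ε, deriv (deriv r) t = deriv r t ^ 2 * F (r t) := by
  have hprim : ∀ f : ℝ → ℝ, ContDiffOn ℝ ∞ f (Ioi 0) →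
      (∀ x ∈ Ioi (0 : ℝ), HasDerivAt (fun x => ∫ s in r₀..x, f s) (f x) x) ∧
        ContDiffOn ℝ ∞ (fun x => ∫ s in r₀..x, f s) (Ioi 0) := by
    intro f hf
    have hd : ∀ x ∈ Ioi (0 : ℝ), HasDerivAt (fun x => ∫ s in r₀..x, f s) (f x) x := by
      intro x hx
      refine intervalIntegral.integral_hasDerivAt_right ?_ ?_
        (hf.continuousOn.continuousAt (Ioi_mem_nhds hx))
      · exact (hf.continuousOn.mono fun s hs =>
          (lt_min hr₀ hx).trans_le hs.1).intervalIntegrable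
      · exact hf.continuousOn.stronglyMeasurableAtFilter isOpen_Ioi x hx
    refine ⟨hd, (contDiffOn_infty_iff_deriv_of_isOpen isOpen_Ioi).2
      ⟨fun x hx => (hd x hx).differentiableAt.differentiableWithinAt, hf.congr fun x hx =>
        (hd x hx).deriv⟩⟩
  obtain ⟨hΦ, hΦs⟩ := hprim F hF
  set Φ : ℝ → ℝ := fun x => ∫ s in r₀..x, F s
  obtain ⟨hW, hWs⟩ := hprim (fun x => Real.exp (-Φ x)) hΦs.neg.exp
  set W : ℝ → ℝ := fun x => ∫ s in r₀..x, Real.exp (-Φ s) with hWdef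
  have hW0 : W r₀ = 0 := intervalIntegral.integral_same
  have hΦ0 : Φ r₀ = 0 := intervalIntegral.integral_same
  have hWr := hWs.contDiffAt (Ioi_mem_nhds hr₀)
  have hWd := (hW r₀ hr₀).hasFDerivAt
  let e := ContDiffAt.toOpenPartialHomeomorph W (f' := ContinuousLinearEquiv.unitsEquivAut ℝ
    (Units.mk0 (Real.exp (-Φ r₀)) (Real.exp_pos _).ne')) hWr (by
      refine hWd.congr_fderiv ?_
      ext
      simp) (by simp)
  have he : ∀ x, e x = W x := fun x => rfl
  have hr₀e : r₀ ∈ e.source := ContDiffAt.mem_toOpenPartialHomeomorph_source _ _ _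
  have h0t : (0 : ℝ) ∈ e.target := by
    have := e.map_source hr₀e
    rwa [he, hW0] at this
  have hsymm0 : e.symm 0 = r₀ := by
    have := e.left_inv hr₀e
    rwa [he, hW0] at this
  have hcont : ContinuousAt (fun t => e.symm (a * t)) 0 := by
    have h1 : ContinuousAt e.symm (a * 0) := by
      rw [mul_zero]
      exact e.continuousAt_symm h0t
    exact ContinuousAt.comp (g := e.symm) (f := fun t => a * t) h1 (by fun_prop)
  have hev : ∀ᶠ t in 𝓝 (0 : ℝ), a * t ∈ e.target ∧ 0 < e.symm (a * t) := by
    have h1 : ContinuousAt (fun t => a * t) (0 : ℝ) := by fun_prop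
    refine (h1.eventually (e.open_target.mem_nhds (by simpa using h0t))).and
      (hcont.eventually (lt_mem_nhds (by simpa [hsymm0] using hr₀)))
  obtain ⟨ε, hε, hball⟩ := Metric.eventually_nhds_iff.1 hev
  have hIoo : ∀ t ∈ Ioo (-ε) ε, a * t ∈ e.target ∧ 0 < e.symm (a * t) := fun t ht =>
    hball (by rw [Real.dist_eq, sub_zero]; exact abs_lt.2 ht)
  have hsd : ∀ t ∈ Ioo (-ε) ε,
      HasDerivAt (fun t => e.symm (a * t)) (a * Real.exp (Φ (e.symm (a * t)))) t := by
    intro t ht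
    obtain ⟨h1, h2⟩ := hIoo t ht
    have h3 : HasDerivAt e (Real.exp (-Φ (e.symm (a * t)))) (e.symm (a * t)) := hW _ h2
    have h4 := e.hasDerivAt_symm h1 (Real.exp_pos _).ne' h3
    have h5 := HasDerivAt.comp (h₂ := e.symm) t h4 ((hasDerivAt_id t).const_mul a)
    refine h5.congr_deriv ?_
    rw [Real.exp_neg, inv_inv]
    ring
  refine ⟨ε, hε, fun t => e.symm (a * t), ?_, fun t ht => (hIoo t ht).2, by simp [hsymm0], ?_, ?_⟩
  · intro t ht
    obtain ⟨h1, h2⟩ := hIoo t ht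
    have h3 : HasDerivAt e (Real.exp (-Φ (e.symm (a * t)))) (e.symm (a * t)) := hW _ h2
    have h4 : ContDiffAt ℝ ∞ e (e.symm (a * t)) := hWs.contDiffAt (Ioi_mem_nhds h2)
    have h5 := e.contDiffAt_symm_deriv (Real.exp_pos _).ne' h1 h3 h4
    exact (ContDiffAt.comp (g := e.symm) t h5
      (contDiffAt_const.mul contDiffAt_id)).contDiffWithinAt
  · have := hsd 0 ⟨by linarith, hε⟩
    simpa [hsymm0, hΦ0] using this
  · intro t ht
    have h1 : deriv (fun t => e.symm (a * t)) =ᶠ[𝓝 t]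
        fun t => a * Real.exp (Φ (e.symm (a * t))) := by
      filter_upwards [Ioo_mem_nhds ht.1 ht.2] with s hs using (hsd s hs).deriv
    rw [h1.deriv_eq, h1.self_of_nhds]
    have h2 := ((HasDerivAt.comp (h₂ := Φ) t (hΦ _ (hIoo t ht).2) (hsd t ht)).exp).const_mul a
    refine h2.deriv.trans ?_
    simp only [Function.comp]
    ring

/-! ### Multiples of a metric are parallel -/

section Parallel
variable {n : ℕ} {M : Type*} [TopologicalSpace M] [ChartedSpace (Model n) M]
  [IsManifold (𝓡 n) ∞ M]

theorem coeff_comm (g : SymTensor n M) (x₀ : M) (j k : Fin n) : coeff g x₀ j k = coeff g x₀ k j :=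
  funext fun _ => g.2 _ _ _

theorem invCoeff_comm (g : SymTensor n M) (x₀ : M) (j k : Fin n) (y : Model n) :
    invCoeff g x₀ j k y = invCoeff g x₀ k j y := by
  have hs : (frameMatrix (coordFrame x₀ y) (g.raw ((extChartAt (𝓡 n) x₀).symm y))).transpose =
      frameMatrix (coordFrame x₀ y) (g.raw ((extChartAt (𝓡 n) x₀).symm y)) := by
    ext i j
    exact g.2 _ _ _
  have := congrFun (congrFun (Matrix.transpose_nonsing_inv (A := frameMatrix (coordFrame x₀ y)
    (g.raw ((extChartAt (𝓡 n) x₀).symm y)))) k) j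
  rw [hs] at this
  exact this

theorem sum_invCoeff_mul_coeff {g : SymTensor n M} (hg : g ∈ riemannianMetrics n M) (x₀ : M)
    {y : Model n} (hy : y ∈ (extChartAt (𝓡 n) x₀).target) (q k : Fin n) :
    ∑ l, invCoeff g x₀ l q y * coeff g x₀ l k y = if q = k then 1 else 0 := by
  have hdet := (posDef_frameMatrix hg (linearIndependent_coordFrame x₀ hy)).det_pos.ne'.isUnit
  have := congrFun (congrFun (Matrix.nonsing_inv_mul _ hdet) q) k
  rw [Matrix.mul_apply, Matrix.one_apply] at this
  rw [← this]
  exact Finset.sum_congr rfl fun l _ => by rw [invCoeff_comm]; rfl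

theorem sum_christoffel_mul_coeff {g : SymTensor n M} (hg : g ∈ riemannianMetrics n M) (x₀ : M)
    {y : Model n} (hy : y ∈ (extChartAt (𝓡 n) x₀).target) (i j k : Fin n) :
    ∑ l, christoffel g x₀ l i j y * coeff g x₀ l k y =
      1 / 2 * (partialDeriv i (coeff g x₀ j k) y + partialDeriv j (coeff g x₀ i k) y -
        partialDeriv k (coeff g x₀ i j) y) := by
  simp only [christoffel, mul_assoc, ← Finset.mul_sum, Finset.sum_mul]
  rw [Finset.sum_comm]
  congr 1
  have h1 : ∀ q, ∑ l, invCoeff g x₀ l q y * ((partialDeriv i (coeff g x₀ j q) y +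
      partialDeriv j (coeff g x₀ i q) y - partialDeriv q (coeff g x₀ i j) y) * coeff g x₀ l k y) =
      (if q = k then 1 else 0) * (partialDeriv i (coeff g x₀ j q) y +
        partialDeriv j (coeff g x₀ i q) y - partialDeriv q (coeff g x₀ i j) y) := fun q => by
    rw [← sum_invCoeff_mul_coeff hg x₀ hy, Finset.sum_mul]
    exact Finset.sum_congr rfl fun l _ => by ring
  simp only [h1, ite_mul, one_mul, zero_mul, Finset.sum_ite_eq', Finset.mem_univ, if_true]

/-- Constant multiples of a metric are parallel for its Levi-Civita connection. -/
theorem covDeriv_smul_self {g : SymTensor n M} (hg : g ∈ riemannianMetrics n M) (b : ℝ) (x₀ : M)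
    {y : Model n} (hy : y ∈ (extChartAt (𝓡 n) x₀).target) (i j k : Fin n) :
    covDeriv g (b • g) x₀ i j k y = 0 := by
  have hc : ∀ j k, coeff (b • g) x₀ j k = fun z => b * coeff g x₀ j k z := fun j k => rfl
  have hd : partialDeriv i (coeff (b • g) x₀ j k) y = b * partialDeriv i (coeff g x₀ j k) y := by
    rw [hc]
    have := fderiv_const_smul_field (𝕜 := ℝ) b (f := coeff g x₀ j k)
    exact congrArg (fun L : Model n → Model n →L[ℝ] ℝ => L y (stdVec i)) this
  rw [covDeriv, hd]
  simp only [hc, mul_left_comm _ b, ← Finset.mul_sum]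
  simp only [coeff_comm g x₀ j _]
  rw [sum_christoffel_mul_coeff hg x₀ hy]
  rw [sum_christoffel_mul_coeff hg x₀ hy i k j, coeff_comm g x₀ k j]
  ring

theorem nablaStar_smul_self {g : SymTensor n M} (hg : g ∈ riemannianMetrics n M) (b : ℝ) (x : M)
    (X : TangentSpace (𝓡 n) x) : nablaStar g (b • g) x X = 0 := by
  simp only [nablaStar, covDeriv_smul_self hg b x (mem_extChartAt_target (I := 𝓡 n) x), mul_zero,
    zero_mul, Finset.sum_const_zero, neg_zero]

end Parallel

/-! ### Geodesics in the ray -/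

section Velocity
variable {n : ℕ} {M : Type*} [TopologicalSpace M] [ChartedSpace (Model n) M]
  [IsManifold (𝓡 n) ∞ M]

theorem HasVelocity.unique {c : ℝ → SymTensor n M} {t : ℝ} {h k : SymTensor n M}
    (hh : HasVelocity c t h) (hk : HasVelocity c t k) : h = k := by
  refine Subtype.ext (ContMDiffSection.ext fun x => ?_)
  refine ContinuousLinearMap.ext fun u => ContinuousLinearMap.ext fun v => ?_
  exact (hh x u v).unique (hk x u v)

theorem HasVelocity.congr_of_eventuallyEq {c d : ℝ → SymTensor n M} {t : ℝ} {h : SymTensor n M}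
    (hc : HasVelocity c t h) (hd : d =ᶠ[𝓝 t] c) : HasVelocity d t h := fun x u v =>
  (hc x u v).congr_of_eventuallyEq (hd.fun_comp fun g => g.1 x u v)

theorem hasVelocity_smul {ρ : ℝ → ℝ} {t a : ℝ} (hρ : HasDerivAt ρ a t) (h : SymTensor n M) :
    HasVelocity (fun s => ρ s • h) t (a • h) := fun x u v => hρ.mul_const (h.1 x u v)

theorem exists_apply_pos (hn : 0 < n) [Nonempty M] {g : SymTensor n M}
    (hg : g ∈ riemannianMetrics n M) : ∃ (x : M) (u : TangentSpace (𝓡 n) x), 0 < g.1 x u u := by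
  obtain ⟨x⟩ := ‹Nonempty M›
  refine ⟨x, stdFrame x ⟨0, hn⟩, hg x _ ?_⟩
  exact (linearIndependent_stdFrame x).ne_zero _

theorem smul_left_injective_of_metric (hn : 0 < n) [Nonempty M] {g : SymTensor n M}
    (hg : g ∈ riemannianMetrics n M) {a b : ℝ} (h : a • g = b • g) : a = b := by
  obtain ⟨x, u, hu⟩ := exists_apply_pos hn hg
  have : a * g.1 x u u = b * g.1 x u u :=
    congrArg (fun k : SymTensor n M => k.1 x u u) h
  exact mul_right_cancel₀ hu.ne' this

/-- A curve of multiples of a metric has a multiple of that metric as velocity; differentiability of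
the coefficient is read off at a point where the metric does not vanish. -/
theorem HasVelocity.exists_eq_smul (hn : 0 < n) [Nonempty M] {g : SymTensor n M}
    (hg : g ∈ riemannianMetrics n M) {c : ℝ → SymTensor n M} {t : ℝ} {h : SymTensor n M}
    (hc : HasVelocity c t h) (hev : ∀ᶠ s in 𝓝 t, ∃ a : ℝ, c s = a • g) : ∃ a : ℝ, h = a • g := by
  obtain ⟨x, u, hu⟩ := exists_apply_pos hn hg
  have h1 := (hc x u u).div_const (g.1 x u u)
  have h2 := hasVelocity_smul h1 g
  refine ⟨_, hc.unique (h2.congr_of_eventuallyEq ?_)⟩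
  filter_upwards [hev] with s ⟨a, ha⟩
  have e : (c s).1 x u u = a * g.1 x u u := by rw [ha]; rfl
  rw [e, mul_div_cancel_right₀ _ hu.ne', ha]

/-- The tangent space of the ray at each of its points is the line spanned by `g₀`. -/
theorem mem_tangentTo_ray_iff (hn : 0 < n) [Nonempty M] {g₀ : SymTensor n M}
    (hg₀ : g₀ ∈ riemannianMetrics n M) {r : ℝ} (hr : 0 < r) (h : SymTensor n M) :
    h ∈ tangentTo (ray g₀) (r • g₀) ↔ ∃ a : ℝ, h = a • g₀ := by
  constructor
  · rintro ⟨c, -, hc, -, hv⟩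
    refine hv.exists_eq_smul hn hg₀ (Eventually.of_forall fun s => ?_)
    obtain ⟨ρ, -, hρ⟩ := hc s
    exact ⟨ρ, hρ⟩
  · rintro ⟨a, rfl⟩
    -- the curve `r exp(a t / r) g₀` stays in the ray for all times
    have hd : HasDerivAt (fun t : ℝ => r * Real.exp (a / r * t)) a 0 := by
      have := (((hasDerivAt_id (0 : ℝ)).const_mul (a / r)).exp).const_mul r
      simpa [mul_div_cancel₀ _ hr.ne'] using this
    refine ⟨fun t => (r * Real.exp (a / r * t)) • g₀, isSmoothCurveOn_smul ?_ g₀,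
      fun t => ⟨_, mul_pos hr (Real.exp_pos _), rfl⟩, by simp, hasVelocity_smul hd g₀⟩
    exact ContDiff.contDiffOn (by fun_prop)

/-- If a smooth operation maps the ray into the line through `g₀`, then the coefficient depends
smoothly on the point of the ray. -/
theorem contDiffOn_of_isSmoothCurveOn_exp (hn : 0 < n) [Nonempty M] {g₀ : SymTensor n M}
    (hg₀ : g₀ ∈ riemannianMetrics n M) {F : ℝ → SymTensor n M} {Ψ : ℝ → ℝ}
    (hF : IsSmoothCurveOn univ fun t => F (Real.exp t)) (hΨ : ∀ r, 0 < r → F r = Ψ r • g₀) :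
    ContDiffOn ℝ ∞ Ψ (Ioi 0) := by
  obtain ⟨x, u, hu⟩ := exists_apply_pos hn hg₀
  have h1 := (contDiffOn_univ.1 (hF.contDiffOn_apply x u u)).div_const (g₀.1 x u u)
  have h2 : ContDiffOn ℝ ∞ Real.log (Ioi 0) :=
    Real.contDiffOn_log.mono fun r hr => (mem_Ioi.1 hr).ne'
  -- `Ψ(r) = Ψ(exp (log r))`
  refine (h1.comp_contDiffOn h2).congr fun r hr => ?_
  have hr' : 0 < r := hr
  have e : (F r).1 x u u = Ψ r * g₀.1 x u u := by rw [hΨ r hr']; rfl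
  simp only [Function.comp, Real.exp_log hr', e, mul_div_cancel_right₀ _ hu.ne']

theorem isSmoothCurveOn_exp_smul (g₀ : SymTensor n M) :
    IsSmoothCurveOn univ fun t => Real.exp t • g₀ :=
  isSmoothCurveOn_smul Real.contDiff_exp.contDiffOn g₀

/-- The adjoint of the derivative of `P` preserves the line through `g₀` along the ray if and only
if its value on the generator is a multiple of `g₀`. -/
theorem forall_adjoint_mem_tangentTo_ray_iff (hn : 0 < n) [Nonempty M]
    {A : SymTensor n M → SymTensor n M →ₗ[ℝ] SymTensor n M →ₗ[ℝ] SymTensor n M} {g₀ : SymTensor n M}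
    (hg₀ : g₀ ∈ riemannianMetrics n M) :
    (∀ g ∈ ray g₀, ∀ h ∈ tangentTo (ray g₀) g, ∀ k ∈ tangentTo (ray g₀) g,
        A g h k ∈ tangentTo (ray g₀) g) ↔
      ∀ r : ℝ, 0 < r → ∃ f : ℝ, A (r • g₀) g₀ g₀ = f • g₀ := by
  constructor
  · intro h r hr
    have h1 : g₀ ∈ tangentTo (ray g₀) (r • g₀) :=
      (mem_tangentTo_ray_iff hn hg₀ hr _).2 ⟨1, (one_smul _ _).symm⟩
    exact (mem_tangentTo_ray_iff hn hg₀ hr _).1 (h _ ⟨r, hr, rfl⟩ _ h1 _ h1)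
  · rintro h _ ⟨r, hr, rfl⟩ h' hh k hk
    rw [mem_tangentTo_ray_iff hn hg₀ hr] at hh hk ⊢
    obtain ⟨a, rfl⟩ := hh
    obtain ⟨b, rfl⟩ := hk
    obtain ⟨f, hf⟩ := h r hr
    refine ⟨a * (b * f), ?_⟩
    rw [LinearMap.map_smul₂, map_smul, hf, smul_smul, smul_smul, mul_assoc]

end Velocity

section Ray
variable {n : ℕ} {M : Type*} [TopologicalSpace M] [ChartedSpace (Model n) M]
  [IsManifold (𝓡 n) ∞ M] [CompactSpace M] [T2Space M]
  {P : SymTensor n M → SymTensor n M →ₗ[ℝ] SymTensor n M}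
  {A : SymTensor n M → SymTensor n M →ₗ[ℝ] SymTensor n M →ₗ[ℝ] SymTensor n M}
  {g₀ : SymTensor n M}

/-- The right-hand side of the geodesic equation at `r g₀` with velocity `a g₀`, as a covector. -/
theorem geodesic_covector_on_ray (hP : IsMetricOperator P) (hA : IsAdjoint P A)
    (hg₀ : g₀ ∈ riemannianMetrics n M) {Ψ : ℝ → ℝ} (hΨ : ∀ r, 0 < r → P (r • g₀) g₀ = Ψ r • g₀)
    {r : ℝ} (hr : 0 < r) (hd : DifferentiableAt ℝ Ψ r) (a : ℝ) (k : SymTensor n M) :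
    1 / 2 * derivMetricP P (r • g₀) k (a • g₀) (a • g₀) -
        derivMetricP P (r • g₀) (a • g₀) (a • g₀) k =
      innerL2 (r • g₀) (a ^ 2 • ((1 / 2 : ℝ) • A (r • g₀) g₀ g₀ +
        ((1 - (n : ℝ) / 4) * Ψ r / r - deriv Ψ r) • g₀)).raw k.raw := by
  have hg := smul_mem_riemannianMetrics hg₀ hr
  have h1 := derivMetricP_smul_smul P (r • g₀) (a • g₀) a 1 g₀ k
  rw [one_smul] at h1
  rw [h1, derivMetricP_smul_smul, derivMetricP_smul_direction,
    derivMetricP_of_direction hP hg₀ hr (hΨ r hr), derivMetricP_of_ray hg₀ hΨ hr hd,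
    hA.adjoint _ hg, innerL2_comm _ k.raw, innerL2_smul_left, innerL2_add_left hg,
    innerL2_smul_left, innerL2_smul_left]
  ring

/-- The geodesic equation at `r g₀` with velocity `a g₀` and acceleration `b g₀`: the weak form,
tested against all `k`, is an equation of tensor fields. -/
theorem geodesic_equation_on_ray_iff (hP : IsMetricOperator P) (hA : IsAdjoint P A)
    (hg₀ : g₀ ∈ riemannianMetrics n M) {Ψ : ℝ → ℝ} (hΨ : ∀ r, 0 < r → P (r • g₀) g₀ = Ψ r • g₀)
    {r : ℝ} (hr : 0 < r) (hd : DifferentiableAt ℝ Ψ r) (a b : ℝ) :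
    (∀ k : SymTensor n M, metricP P (r • g₀) (b • g₀) k =
      1 / 2 * derivMetricP P (r • g₀) k (a • g₀) (a • g₀) -
        derivMetricP P (r • g₀) (a • g₀) (a • g₀) k) ↔
      (b * Ψ r) • g₀ = a ^ 2 • ((1 / 2 : ℝ) • A (r • g₀) g₀ g₀ +
        ((1 - (n : ℝ) / 4) * Ψ r / r - deriv Ψ r) • g₀) := by
  have hg := smul_mem_riemannianMetrics hg₀ hr
  simp only [geodesic_covector_on_ray hP hA hg₀ hΨ hr hd, metricP, map_smul, hΨ r hr, smul_smul]
  exact ⟨fun h => ext_innerL2 hP hg h, fun h k => by rw [h]⟩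

/-- Positivity of `P`: in `P_{r g₀} g₀ = p g₀` neither `p` nor the norm of `g₀` vanishes. -/
theorem innerL2_ray_ne_zero (hn : 0 < n) [Nonempty M] (hP : IsMetricOperator P)
    (hg₀ : g₀ ∈ riemannianMetrics n M) {r p : ℝ} (hr : 0 < r) (hp : P (r • g₀) g₀ = p • g₀) :
    p * innerL2 (r • g₀) g₀.raw g₀.raw ≠ 0 := by
  have hne : g₀ ≠ 0 := by
    rintro rfl
    obtain ⟨x, u, hu⟩ := exists_apply_pos hn hg₀
    exact lt_irrefl _ hu
  have := hP.positive _ (smul_mem_riemannianMetrics hg₀ hr) g₀ hne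
  rw [hp, innerL2_smul_left] at this
  exact this.ne'

theorem isNormalTo_ray_iff (hn : 0 < n) [Nonempty M] (hg₀ : g₀ ∈ riemannianMetrics n M) {r : ℝ}
    (hr : 0 < r) (m : RawTensor n M) :
    IsNormalTo (ray g₀) (r • g₀) m ↔ innerL2 (r • g₀) m g₀.raw = 0 := by
  constructor
  · intro h
    exact h g₀ ((mem_tangentTo_ray_iff hn hg₀ hr _).2 ⟨1, (one_smul _ _).symm⟩)
  · intro h k hk
    obtain ⟨a, rfl⟩ := (mem_tangentTo_ray_iff hn hg₀ hr _).1 hk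
    rw [innerL2_smul_right, h, mul_zero]

/-- The derivative of `P` preserves normality to the ray if and only if the value of its adjoint on
the generator is a multiple of `g₀`. -/
theorem forall_isNormalTo_derivOperator_iff (hn : 0 < n) [Nonempty M] (hP : IsMetricOperator P)
    (hA : IsAdjoint P A) (hg₀ : g₀ ∈ riemannianMetrics n M)
    (hline : ∀ r : ℝ, 0 < r → ∃ p : ℝ, P (r • g₀) g₀ = p • g₀) :
    (∀ g ∈ ray g₀, ∀ h ∈ tangentTo (ray g₀) g, ∀ m : SymTensor n M,
        IsNormalTo (ray g₀) g m.raw → IsNormalTo (ray g₀) g (derivOperator P g m h)) ↔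
      ∀ r : ℝ, 0 < r → ∃ f : ℝ, A (r • g₀) g₀ g₀ = f • g₀ := by
  constructor
  · intro h r hr
    have hg := smul_mem_riemannianMetrics hg₀ hr
    obtain ⟨p, hp⟩ := hline r hr
    have hq : innerL2 (r • g₀) g₀.raw g₀.raw ≠ 0 :=
      right_ne_zero_of_mul (innerL2_ray_ne_zero hn hP hg₀ hr hp)
    set q := innerL2 (r • g₀) g₀.raw g₀.raw with hqdef
    refine ⟨innerL2 (r • g₀) (A (r • g₀) g₀ g₀).raw g₀.raw / q, ext_innerL2 hP hg fun k => ?_⟩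
    -- split `k` into its component along `g₀` and a normal field `m`
    obtain ⟨b, hb⟩ : ∃ b : ℝ, b * q = innerL2 (r • g₀) k.raw g₀.raw :=
      ⟨_, div_mul_cancel₀ _ hq⟩
    obtain ⟨m, hm⟩ : ∃ m : SymTensor n M, k = m + b • g₀ := ⟨k - b • g₀, by abel⟩
    have hm0 : innerL2 (r • g₀) m.raw g₀.raw = 0 := by
      rw [hm, innerL2_add_left hg, innerL2_smul_left, ← hqdef] at hb
      linarith
    have h1 := (isNormalTo_ray_iff hn hg₀ hr _).1 (h (r • g₀) ⟨r, hr, rfl⟩ g₀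
      ((mem_tangentTo_ray_iff hn hg₀ hr _).2 ⟨1, (one_smul _ _).symm⟩) m
      ((isNormalTo_ray_iff hn hg₀ hr _).2 hm0))
    rw [hA.adjoint _ hg, innerL2_comm] at h1
    rw [hm, innerL2_add_right hg, innerL2_smul_right, h1, innerL2_smul_left, innerL2_add_right hg,
      innerL2_smul_right, innerL2_comm _ g₀.raw m.raw, hm0, ← hqdef]
    field_simp
    ring
  · rintro h _ ⟨r, hr, rfl⟩ h' hh m hm
    have hg := smul_mem_riemannianMetrics hg₀ hr
    obtain ⟨a, rfl⟩ := (mem_tangentTo_ray_iff hn hg₀ hr _).1 hh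
    obtain ⟨f, hf⟩ := h r hr
    rw [isNormalTo_ray_iff hn hg₀ hr] at hm ⊢
    rw [hA.adjoint _ hg, map_smul, LinearMap.smul_apply, hf, innerL2_smul_right,
      innerL2_smul_right, hm, mul_zero, mul_zero]

/-- A totally geodesic ray contains a geodesic with velocity `g₀` through each of its points, and
its geodesic equation expresses `A g₀ g₀` as a multiple of `g₀`. -/
theorem IsTotallyGeodesic.exists_adjoint_eq_smul (hn : 0 < n) [Nonempty M]
    (hP : IsMetricOperator P) (hA : IsAdjoint P A) (hg₀ : g₀ ∈ riemannianMetrics n M)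
    {Ψ : ℝ → ℝ} (hΨ : ∀ r, 0 < r → P (r • g₀) g₀ = Ψ r • g₀)
    (hd : DifferentiableOn ℝ Ψ (Ioi 0)) (hT : IsTotallyGeodesic P (ray g₀)) {r : ℝ} (hr : 0 < r) :
    ∃ f : ℝ, A (r • g₀) g₀ g₀ = f • g₀ := by
  obtain ⟨ε, hε, c, ⟨-, -, v, a, hva⟩, hc0, hv0, hray⟩ := hT (r • g₀) ⟨r, hr, rfl⟩ g₀
    ((mem_tangentTo_ray_iff hn hg₀ hr _).2 ⟨1, (one_smul _ _).symm⟩)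
  have h0 : (0 : ℝ) ∈ Ioo (-ε) ε := ⟨by linarith, hε⟩
  -- the velocity, and then the acceleration, are multiples of `g₀`
  have hv : ∀ t ∈ Ioo (-ε) ε, ∃ α : ℝ, v t = α • g₀ := fun t ht =>
    (hva t ht).1.exists_eq_smul hn hg₀ (by
      filter_upwards [Ioo_mem_nhds ht.1 ht.2] with s hs
      obtain ⟨ρ, -, hρ⟩ := hray s hs
      exact ⟨ρ, hρ⟩)
  obtain ⟨β, hβ⟩ : ∃ β : ℝ, a 0 = β • g₀ :=
    (hva 0 h0).2.1.exists_eq_smul hn hg₀ (by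
      filter_upwards [Ioo_mem_nhds h0.1 h0.2] with s hs using hv s hs)
  have hv1 : v 0 = (1 : ℝ) • g₀ := by rw [one_smul]; exact (hva 0 h0).1.unique hv0
  have heq := (hva 0 h0).2.2
  rw [hc0, hβ, hv1] at heq
  have := (geodesic_equation_on_ray_iff hP hA hg₀ hΨ hr
    (hd.differentiableAt (Ioi_mem_nhds hr)) 1 β).1 heq
  refine ⟨2 * (β * Ψ r - ((1 - (n : ℝ) / 4) * Ψ r / r - deriv Ψ r)), ?_⟩
  rw [mul_smul, sub_smul, this]
  module

/-- On the ray the geodesic equation is an ordinary differential equation for the scalar factor. -/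
theorem isGeodesicOn_smul_iff (hn : 0 < n) [Nonempty M]
    (hP : IsMetricOperator P) (hA : IsAdjoint P A) (hg₀ : g₀ ∈ riemannianMetrics n M)
    {Ψ f : ℝ → ℝ} (hΨ : ∀ r, 0 < r → P (r • g₀) g₀ = Ψ r • g₀)
    (hf : ∀ r, 0 < r → A (r • g₀) g₀ g₀ = f r • g₀)
    (hd : DifferentiableOn ℝ Ψ (Ioi 0)) {J : Set ℝ} (hJ : IsOpen J) {r : ℝ → ℝ}
    (hr : ContDiffOn ℝ ∞ r J) (hpos : ∀ t ∈ J, 0 < r t) :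
    IsGeodesicOn P J (fun t => r t • g₀) ↔
      ∀ t ∈ J, deriv (deriv r) t * Ψ (r t) =
        deriv r t ^ 2 *
          (1 / 2 * f (r t) - deriv Ψ (r t) + (1 - (n : ℝ) / 4) * Ψ (r t) / r t) := by
  have hr1 : ∀ t ∈ J, HasDerivAt r (deriv r t) t := fun t ht =>
    ((hr.contDiffAt (hJ.mem_nhds ht)).differentiableAt (by simp)).hasDerivAt
  have hr' : ContDiffOn ℝ ∞ (deriv r) J := ((contDiffOn_infty_iff_deriv_of_isOpen hJ).1 hr).2
  have hr2 : ∀ t ∈ J, HasDerivAt (deriv r) (deriv (deriv r) t) t := fun t ht =>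
    ((hr'.contDiffAt (hJ.mem_nhds ht)).differentiableAt (by simp)).hasDerivAt
  have hscalar : ∀ t ∈ J, (∀ k : SymTensor n M,
      metricP P (r t • g₀) (deriv (deriv r) t • g₀) k =
        1 / 2 * derivMetricP P (r t • g₀) k (deriv r t • g₀) (deriv r t • g₀) -
          derivMetricP P (r t • g₀) (deriv r t • g₀) (deriv r t • g₀) k) ↔
      deriv (deriv r) t * Ψ (r t) = deriv r t ^ 2 *
          (1 / 2 * f (r t) - deriv Ψ (r t) + (1 - (n : ℝ) / 4) * Ψ (r t) / r t) := by
    intro t ht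
    rw [geodesic_equation_on_ray_iff hP hA hg₀ hΨ (hpos t ht)
      (hd.differentiableAt (Ioi_mem_nhds (hpos t ht))), hf _ (hpos t ht), smul_smul, ← add_smul,
      smul_smul]
    have e : 1 / 2 * f (r t) + ((1 - (n : ℝ) / 4) * Ψ (r t) / r t - deriv Ψ (r t)) =
      1 / 2 * f (r t) - deriv Ψ (r t) + (1 - (n : ℝ) / 4) * Ψ (r t) / r t := by ring
    rw [e]
    exact ⟨smul_left_injective_of_metric hn hg₀, fun h => by rw [h]⟩
  constructor
  · rintro ⟨-, -, v, a, hva⟩ t ht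
    have hv : ∀ s ∈ J, v s = deriv r s • g₀ := fun s hs =>
      (hva s hs).1.unique (hasVelocity_smul (hr1 s hs) g₀)
    have ha : a t = deriv (deriv r) t • g₀ := by
      refine (hva t ht).2.1.unique
        ((hasVelocity_smul (hr2 t ht) g₀).congr_of_eventuallyEq ?_)
      filter_upwards [hJ.mem_nhds ht] with s hs using hv s hs
    have heq := (hva t ht).2.2
    rw [ha, hv t ht] at heq
    exact (hscalar t ht).1 heq
  · intro h
    exact ⟨isSmoothCurveOn_smul hr g₀, fun t ht => smul_mem_riemannianMetrics hg₀ (hpos t ht),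
      fun t => deriv r t • g₀, fun t => deriv (deriv r) t • g₀, fun t ht =>
        ⟨hasVelocity_smul (hr1 t ht) g₀, hasVelocity_smul (hr2 t ht) g₀,
          (hscalar t ht).2 (h t ht)⟩⟩

/-- The converse: if `A g₀ g₀` is a multiple of `g₀` along the ray, the equation for the scalar
factor has a smooth positive local solution for all initial data. -/
theorem isTotallyGeodesic_ray (hn : 0 < n) [Nonempty M]
    (hP : IsMetricOperator P) (hA : IsAdjoint P A) (hg₀ : g₀ ∈ riemannianMetrics n M)
    {Ψ f : ℝ → ℝ} (hΨ : ∀ r, 0 < r → P (r • g₀) g₀ = Ψ r • g₀)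
    (hf : ∀ r, 0 < r → A (r • g₀) g₀ g₀ = f r • g₀)
    (hΨs : ContDiffOn ℝ ∞ Ψ (Ioi 0)) (hfs : ContDiffOn ℝ ∞ f (Ioi 0)) :
    IsTotallyGeodesic P (ray g₀) := by
  rintro _ ⟨r₀, hr₀, rfl⟩ h hh
  obtain ⟨a, rfl⟩ := (mem_tangentTo_ray_iff hn hg₀ hr₀ _).1 hh
  have hΨ0 : ∀ r, 0 < r → Ψ r ≠ 0 := fun r hr =>
    left_ne_zero_of_mul (innerL2_ray_ne_zero hn hP hg₀ hr (hΨ r hr))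
  have hd := hΨs.differentiableOn (by simp : (∞ : WithTop ℕ∞) ≠ 0)
  have hF : ContDiffOn ℝ ∞ (fun r => (1 / 2 * f r - deriv Ψ r + (1 - (n : ℝ) / 4) * Ψ r / r) / Ψ r)
      (Ioi 0) := by
    have hΨ' := ((contDiffOn_infty_iff_deriv_of_isOpen isOpen_Ioi).1 hΨs).2
    exact (((contDiffOn_const.mul hfs).sub hΨ').add ((contDiffOn_const.mul hΨs).div contDiffOn_id
      fun r hr => (mem_Ioi.1 hr).ne')).div hΨs fun r hr => hΨ0 r hr
  obtain ⟨ε, hε, r, hrs, hpos, h0, hd0, hode⟩ := exists_smooth_solution_of_deriv_deriv_eq hF hr₀ a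
  refine ⟨ε, hε, fun t => r t • g₀, ?_, by simp only [h0], hasVelocity_smul hd0 g₀,
    fun t ht => ⟨r t, hpos t ht, rfl⟩⟩
  rw [isGeodesicOn_smul_iff hn hP hA hg₀ hΨ hf hd isOpen_Ioo hrs hpos]
  intro t ht
  rw [hode t ht, mul_assoc, div_mul_cancel₀ _ (hΨ0 _ (hpos t ht))]

end Ray

end MetricSpaceOfMetrics

theorem mainTheorem3 (n : ℕ) (hn : 0 < n) (M : Type*) [TopologicalSpace M]
    [ChartedSpace (Model n) M] [IsManifold (𝓡 n) ∞ M] [CompactSpace M] [T2Space M] [Nonempty M]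
    (P : SymTensor n M → SymTensor n M →ₗ[ℝ] SymTensor n M) (hP : IsMetricOperator P)
    (A : SymTensor n M → SymTensor n M →ₗ[ℝ] SymTensor n M →ₗ[ℝ] SymTensor n M)
    (hA : IsAdjoint P A)
    (g₀ : SymTensor n M) (hg₀ : g₀ ∈ riemannianMetrics n M)
    (hres : ∀ g ∈ ray g₀, ∀ h ∈ tangentTo (ray g₀) g, P g h ∈ tangentTo (ray g₀) g) :
    (IsTotallyGeodesic P (ray g₀) ↔
      ∀ g ∈ ray g₀, ∀ h ∈ tangentTo (ray g₀) g, ∀ k ∈ tangentTo (ray g₀) g,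
        A g h k ∈ tangentTo (ray g₀) g) ∧
    (IsTotallyGeodesic P (ray g₀) ↔
      ∀ g ∈ ray g₀, ∀ h ∈ tangentTo (ray g₀) g, ∀ m : SymTensor n M,
        IsNormalTo (ray g₀) g m.raw → IsNormalTo (ray g₀) g (derivOperator P g m h)) ∧
    (IsTotallyGeodesic P (ray g₀) →
      ∃ Ψ f : ℝ → ℝ,
        (∀ r : ℝ, 0 < r → P (r • g₀) g₀ = Ψ r • g₀ ∧ A (r • g₀) g₀ g₀ = f r • g₀) ∧
        DifferentiableOn ℝ Ψ (Ioi 0) ∧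
        ∀ (J : Set ℝ) (r : ℝ → ℝ), IsOpen J → ContDiffOn ℝ ∞ r J → (∀ t ∈ J, 0 < r t) →
          (IsGeodesicOn P J (fun t => r t • g₀) ↔
            ∀ t ∈ J, deriv (deriv r) t * Ψ (r t) =
              deriv r t ^ 2 *
                (1 / 2 * f (r t) - deriv Ψ (r t) + (1 - (n : ℝ) / 4) * Ψ (r t) / r t)) ∧
          (IsGeodesicOn P J (fun t => r t • g₀) →
            ∀ t ∈ J, ∀ h : SymTensor n M, HasVelocity (fun s => r s • g₀) t h →
              ∀ (x : M) (X : TangentSpace (𝓡 n) x) (w : Fin n → TangentSpace (𝓡 n) x),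
                momentum P (r t • g₀) h x X w = 0)) := by
  have hg₀T : ∀ r : ℝ, 0 < r → g₀ ∈ tangentTo (ray g₀) (r • g₀) := fun r hr =>
    (mem_tangentTo_ray_iff hn hg₀ hr _).2 ⟨1, (one_smul _ _).symm⟩
  have hline : ∀ r : ℝ, 0 < r → ∃ p : ℝ, P (r • g₀) g₀ = p • g₀ := fun r hr =>
    (mem_tangentTo_ray_iff hn hg₀ hr _).1 (hres _ ⟨r, hr, rfl⟩ _ (hg₀T r hr))
  have hmet : ∀ t : ℝ, Real.exp t • g₀ ∈ riemannianMetrics n M := fun t =>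
    smul_mem_riemannianMetrics hg₀ (Real.exp_pos t)
  choose! Ψ hΨ using hline
  have hΨs : ContDiffOn ℝ ∞ Ψ (Ioi 0) :=
    contDiffOn_of_isSmoothCurveOn_exp hn hg₀ (F := fun r => P (r • g₀) g₀)
      (hP.smooth _ _ (isSmoothCurveOn_exp_smul g₀) (isSmoothCurveOn_const univ g₀) hmet) hΨ
  have hd := hΨs.differentiableOn (by simp : (∞ : WithTop ℕ∞) ≠ 0)
  have hfs : ∀ f : ℝ → ℝ, (∀ r : ℝ, 0 < r → A (r • g₀) g₀ g₀ = f r • g₀) →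
      ContDiffOn ℝ ∞ f (Ioi 0) := fun f hf =>
    contDiffOn_of_isSmoothCurveOn_exp hn hg₀ (F := fun r => A (r • g₀) g₀ g₀)
      (hA.smooth _ _ _ (isSmoothCurveOn_exp_smul g₀) (isSmoothCurveOn_const univ g₀)
        (isSmoothCurveOn_const univ g₀) hmet) hf
  have hiff : IsTotallyGeodesic P (ray g₀) ↔
      ∀ r : ℝ, 0 < r → ∃ f : ℝ, A (r • g₀) g₀ g₀ = f • g₀ := by
    refine ⟨fun hT r hr => hT.exists_adjoint_eq_smul hn hP hA hg₀ hΨ hd hr, fun h => ?_⟩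
    choose! f hf using h
    exact isTotallyGeodesic_ray hn hP hA hg₀ hΨ hf hΨs (hfs f hf)
  refine ⟨hiff.trans (forall_adjoint_mem_tangentTo_ray_iff hn hg₀).symm,
    hiff.trans (forall_isNormalTo_derivOperator_iff hn hP hA hg₀ fun r hr => ⟨_, hΨ r hr⟩).symm,
    fun hT => ?_⟩
  have hA' := hiff.1 hT
  choose! f hf using hA'
  refine ⟨Ψ, f, fun r hr => ⟨hΨ r hr, hf r hr⟩, hd, fun J r hJ hr hpos =>
    ⟨isGeodesicOn_smul_iff hn hP hA hg₀ hΨ hf hd hJ hr hpos, fun _ t ht h hh x X w => ?_⟩⟩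
  have hh' : h = deriv r t • g₀ := hh.unique (hasVelocity_smul
    ((hr.contDiffAt (hJ.mem_nhds ht)).differentiableAt (by simp)).hasDerivAt g₀)
  have hPh : P (r t • g₀) h = (deriv r t * Ψ (r t) / r t) • (r t • g₀) := by
    rw [hh', map_smul, hΨ _ (hpos t ht), smul_smul, smul_smul,
      div_mul_cancel₀ _ (hpos t ht).ne']
  rw [momentum, hPh, nablaStar_smul_self (smul_mem_riemannianMetrics hg₀ (hpos t ht)), zero_mul]
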